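/- Tile $\mathbb{R}^2$ by the unit squares centred at the points of $\mathbb{Z}^2$; each square is either occupied or vacant, and the square $S_0$ centred at the origin is occupied. Two distinct squares are star adjacent if they share a corner. Let $C(0)$ be the set of all squares that can be joined to $S_0$ by a sequence of distinct occupied squares in which consecutive squares are star adjacent. Let $G_0$ be the graph whose vertices and edges are the corners and edges of the squares in $C(0)$. A cycle is a closed path in which every vertex lies on exactly two of its edges, and is regarded as a subgraph (without orientation or starting point); its interior and exterior are the bounded and the unbounded component of its complement in the plane. A square lies in the interior (exterior) of a cycle if its open square does, and an edge lies in the exterior of a cycle if both squares having it as an edge do. An edge of a square is called adjacent to that square. The outermost boundary $\partial_0$ is the set of edges $e$ of $G_0$ such that for every cycle $C$ in $G_0$ either $e$ is an edge of $C$ or $e$ lies in the exterior of $C$. Theorem. Suppose $C(0)$ is finite. Then there is a unique finite set of cycles $C_1,\dots,C_n$ in $G_0$ such that $\partial_0$ is the set of all edges of $C_1,\dots,C_n$ and the following hold: (i) every edge of $\bigcup_{i} C_i$ belongs to $\partial_0$; (ii) the graph $\bigcup_{i} C_i$ is a connected subgraph of $G_0$; (iii) if $i\neq j$, then $C_i$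 and $C_j$ have disjoint interiors and at most one vertex in common; (iv) every square of $C(0)$ lies in the interior of some $C_j$; (v) every edge of $C_j$ is adjacent to a square of $C(0)$ lying in the interior of $C_j$ and to a vacant square lying in the exterior of all the cycles $C_1,\dots,C_n$. Moreover, there is a circuit $C_{out}$ in $G_0$ (a closed walk of positive length that repeats no edge) whose edges are exactly the edges of $\partial_0$. -/

import Mathlib

namespace StarPercolation

/-- The unit squares of the tiling are indexed by their centres `z ∈ ℤ²`; `openSquare z` is the open
unit square with centre `z`. -/
def openSquare (z : ℤ × ℤ) : Set (ℝ × ℝ) :=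
  Set.Ioo ((z.1 : ℝ) - 1 / 2) ((z.1 : ℝ) + 1 / 2) ×ˢ
    Set.Ioo ((z.2 : ℝ) - 1 / 2) ((z.2 : ℝ) + 1 / 2)

/-- The corners of the squares are the points of `(ℤ + 1/2)²`, indexed by `ℤ²`: the index `v` stands
for the point `v + (1/2, 1/2)`. -/
noncomputable def cornerPoint (v : ℤ × ℤ) : ℝ × ℝ :=
  ((v.1 : ℝ) + 1 / 2, (v.2 : ℝ) + 1 / 2)

/-- `IsCornerOf v z`: the point with index `v` is one of the four corners of the square with
centre `z`. -/
def IsCornerOf (v z : ℤ × ℤ) : Prop :=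
  (v.1 = z.1 ∨ v.1 = z.1 - 1) ∧ (v.2 = z.2 ∨ v.2 = z.2 - 1)

/-- Two different squares are star adjacent if they share a corner. -/
def starGraph : SimpleGraph (ℤ × ℤ) where
  Adj z w := z ≠ w ∧ ∃ v, IsCornerOf v z ∧ IsCornerOf v w
  symm := ⟨fun _ _ h => ⟨h.1.symm, h.2.imp fun _ hv => hv.symm⟩⟩
  loopless := ⟨fun _ h => h.1 rfl⟩

/-- The graph formed by all corners and all edges of the squares of the tiling. -/
def gridGraph : SimpleGraph (ℤ × ℤ) where
  Adj u v := (|u.1 - v.1| = 1 ∧ u.2 = v.2) ∨ (u.1 = v.1 ∧ |u.2 - v.2| = 1)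
  symm := ⟨fun u v h => by
    rw [abs_sub_comm v.1 u.1, abs_sub_comm v.2 u.2]
    exact h.imp (fun h => ⟨h.1, h.2.symm⟩) (fun h => ⟨h.1.symm, h.2⟩)⟩
  loopless := ⟨fun _ h => by simp at h⟩

/-- `IsEdgeOf e z`: `e` is one of the four edges of the square with centre `z`. -/
def IsEdgeOf (e : Sym2 (ℤ × ℤ)) (z : ℤ × ℤ) : Prop :=
  e ∈ gridGraph.edgeSet ∧ ∀ v ∈ e, IsCornerOf v z

/-- The star connected occupied component containing the origin, where `occ` is the set of (centres
of) occupied squares: all squares that are joined to the square at the origin by a sequence of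
distinct occupied squares, consecutive ones being star adjacent. -/
def component (occ : Set (ℤ × ℤ)) : Set (ℤ × ℤ) :=
  {z | ∃ p : starGraph.Walk z 0, p.IsPath ∧ ∀ y ∈ p.support, y ∈ occ}

/-- The graph `G₀` of the component: its edges are the edges of the squares of the component.
(Grid points that are not corners of squares of the component are isolated and play no role.) -/
def componentGraph (occ : Set (ℤ × ℤ)) : SimpleGraph (ℤ × ℤ) where
  Adj u v := ∃ z ∈ component occ, IsEdgeOf s(u, v) z
  symm := ⟨fun u v h => by rwa [Sym2.eq_swap]⟩
  loopless := ⟨fun u h => by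
    obtain ⟨z, _, hz⟩ := h
    exact gridGraph.loopless.irrefl u hz.1⟩

section Cycles

variable {G : SimpleGraph (ℤ × ℤ)}

/-- A cycle, as an unoriented subgraph without base point: the graph traced by a closed walk of
positive length that repeats no edge and no vertex (besides its first and last vertex). -/
def IsCycleSubgraph (C : G.Subgraph) : Prop :=
  ∃ (v : ℤ × ℤ) (w : G.Walk v v), w.IsCycle ∧ C = w.toSubgraph

/-- The union of the edges of `C`, as a subset of the plane. -/
def trace (C : G.Subgraph) : Set (ℝ × ℝ) :=
  {p | ∃ u v, C.Adj u v ∧ p ∈ segment ℝ (cornerPoint u) (cornerPoint v)}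

/-- The interior of a cycle: the points off the cycle whose connected component in the complement
of the cycle is bounded. -/
def inside (C : G.Subgraph) : Set (ℝ × ℝ) :=
  {p | p ∉ trace C ∧ Bornology.IsBounded (connectedComponentIn (trace C)ᶜ p)}

/-- The exterior of a cycle: the points off the cycle whose connected component in the complement
of the cycle is unbounded. -/
def outside (C : G.Subgraph) : Set (ℝ × ℝ) :=
  {p | p ∉ trace C ∧ ¬ Bornology.IsBounded (connectedComponentIn (trace C)ᶜ p)}

/-- The square with centre `z` lies in the interior of `C`. -/
def SquareInside (z : ℤ × ℤ) (C : G.Subgraph) : Prop := openSquare z ⊆ inside C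

/-- The square with centre `z` lies in the exterior of `C`. -/
def SquareOutside (z : ℤ × ℤ) (C : G.Subgraph) : Prop := openSquare z ⊆ outside C

/-- An edge belongs to the exterior of `C` if both squares having it as an edge do. -/
def EdgeOutside (e : Sym2 (ℤ × ℤ)) (C : G.Subgraph) : Prop :=
  ∀ z, IsEdgeOf e z → SquareOutside z C

end Cycles

/-- A boundary edge is adjacent to a vacant square and to an occupied square of the component. -/
def IsBoundaryEdge (occ : Set (ℤ × ℤ)) (e : Sym2 (ℤ × ℤ)) : Prop :=
  (∃ z, z ∉ occ ∧ IsEdgeOf e z) ∧ ∃ z ∈ component occ, IsEdgeOf e z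

/-- The outermost boundary `∂₀`: the edges `e` of `G₀` such that, for every cycle `C` in `G₀`,
either `e` is an edge of `C` or `e` belongs to the exterior of `C`. -/
def outermostBoundary (occ : Set (ℤ × ℤ)) : Set (Sym2 (ℤ × ℤ)) :=
  {e | e ∈ (componentGraph occ).edgeSet ∧
    ∀ C : (componentGraph occ).Subgraph, IsCycleSubgraph C → e ∈ C.edgeSet ∨ EdgeOutside e C}

end StarPercolation

/-! Let A be the component. Call a square off A exterior if infinitely many squares can be reached
from it by edge-adjacent steps off A; the filling of A is the set of all other squares, and a block
is an edge-connected component of the filling. The cycles sought are exactly the boundaries of the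
blocks, and `outermostBoundary_eq` identifies the outermost boundary with the boundary of the
filling.

The combinatorial substitute for the Jordan curve theorem is `exists_edgeBoundary_eq_edges`: modulo
2, the edges of a closed trail bound a finite set I of squares. If the trail runs in the graph of A,
then I lies in the filling, since a walk off A cannot cross the trail. If moreover its edges bound
the filling, then I is a union of blocks. Applied to any cycle found inside the boundary of a block,
this forces the cycle to be the whole boundary (`exists_isCycle_block`). Applied to a closed trail
made of an arc from each of two block cycles, it shows that the cycles share at most one vertex.

Interior and exterior are read off from the squares: a finite set bounded by the cycle lies inside,
and a square from which infinitely many squares are reachable without crossing the cycle lies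
outside. Star adjacent squares in different blocks give cycles with a common corner, so the cycles
can be spliced one after another into a circuit; this also gives connectedness. For uniqueness, a
cycle made of outermost edges must be a block cycle, and (iv) forces every block to occur, because
every block contains a square of A. -/

namespace StarPercolation

/-! ### Edges of the tiling and the squares on their two sides -/

/-- The vertical edge with upper corner `(x, y)`, shared by the squares `(x, y)` and
`(x + 1, y)`. -/
def vertEdge (x y : ℤ) : Sym2 (ℤ × ℤ) := s((x, y), (x, y - 1))

/-- The horizontal edge with right corner `(x, y)`, shared by the squares `(x, y)` and
`(x, y + 1)`. -/
def horizEdge (x y : ℤ) : Sym2 (ℤ × ℤ) := s((x, y), (x - 1, y))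

theorem abs_sub_eq_one_iff (a b : ℤ) : |a - b| = 1 ↔ b = a - 1 ∨ b = a + 1 := by
  rw [abs_eq (by norm_num)]; omega

theorem gridGraph_adj_iff (u v : ℤ × ℤ) : gridGraph.Adj u v ↔
    v = (u.1 - 1, u.2) ∨ v = (u.1 + 1, u.2) ∨ v = (u.1, u.2 - 1) ∨ v = (u.1, u.2 + 1) := by
  obtain ⟨a, b⟩ := u
  obtain ⟨c, d⟩ := v
  simp only [gridGraph, abs_sub_eq_one_iff, Prod.mk.injEq]
  omega

theorem vertEdge_mem (x y : ℤ) : vertEdge x y ∈ gridGraph.edgeSet := by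
  simp [vertEdge, gridGraph_adj_iff]

theorem horizEdge_mem (x y : ℤ) : horizEdge x y ∈ gridGraph.edgeSet := by
  simp [horizEdge, gridGraph_adj_iff]

theorem eq_vertEdge_or_horizEdge {e : Sym2 (ℤ × ℤ)} (he : e ∈ gridGraph.edgeSet) :
    (∃ x y, e = vertEdge x y) ∨ ∃ x y, e = horizEdge x y := by
  induction e with
  | h u v =>
    obtain ⟨a, b⟩ := u
    rw [SimpleGraph.mem_edgeSet, gridGraph_adj_iff] at he
    rcases he with rfl | rfl | rfl | rfl
    · exact Or.inr ⟨a, b, rfl⟩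
    · exact Or.inr ⟨a + 1, b, by simp [horizEdge, Sym2.eq_swap]⟩
    · exact Or.inl ⟨a, b, rfl⟩
    · exact Or.inl ⟨a, b + 1, by simp [vertEdge, Sym2.eq_swap]⟩

theorem isEdgeOf_vertEdge (x y : ℤ) (z : ℤ × ℤ) :
    IsEdgeOf (vertEdge x y) z ↔ z = (x, y) ∨ z = (x + 1, y) := by
  obtain ⟨a, b⟩ := z
  simp only [IsEdgeOf, vertEdge_mem, true_and]
  simp only [vertEdge, Sym2.mem_iff, forall_eq_or_imp, forall_eq, IsCornerOf, Prod.mk.injEq]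
  omega

theorem isEdgeOf_horizEdge (x y : ℤ) (z : ℤ × ℤ) :
    IsEdgeOf (horizEdge x y) z ↔ z = (x, y) ∨ z = (x, y + 1) := by
  obtain ⟨a, b⟩ := z
  simp only [IsEdgeOf, horizEdge_mem, true_and]
  simp only [horizEdge, Sym2.mem_iff, forall_eq_or_imp, forall_eq, IsCornerOf, Prod.mk.injEq]
  omega

/-- Every edge of the grid has exactly two sides, which are neighbouring squares. -/
theorem exists_sides {e : Sym2 (ℤ × ℤ)} (he : e ∈ gridGraph.edgeSet) :
    ∃ z w, gridGraph.Adj z w ∧ ∀ y, IsEdgeOf e y ↔ y = z ∨ y = w := by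
  rcases eq_vertEdge_or_horizEdge he with ⟨x, y, rfl⟩ | ⟨x, y, rfl⟩
  · exact ⟨_, _, by simp [gridGraph_adj_iff], isEdgeOf_vertEdge x y⟩
  · exact ⟨_, _, by simp [gridGraph_adj_iff], isEdgeOf_horizEdge x y⟩

theorem adj_of_isEdgeOf {e : Sym2 (ℤ × ℤ)} {z w : ℤ × ℤ} (hz : IsEdgeOf e z) (hw : IsEdgeOf e w)
    (hne : z ≠ w) : gridGraph.Adj z w := by
  obtain ⟨a, b, hab, h⟩ := exists_sides hz.1
  rcases (h z).1 hz with rfl | rfl <;> rcases (h w).1 hw with rfl | rfl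
  exacts [absurd rfl hne, hab, hab.symm, absurd rfl hne]

theorem eq_or_eq_of_isEdgeOf {e : Sym2 (ℤ × ℤ)} {z w : ℤ × ℤ} (hz : IsEdgeOf e z)
    (hw : IsEdgeOf e w) (hne : z ≠ w) {y : ℤ × ℤ} (hy : IsEdgeOf e y) : y = z ∨ y = w := by
  obtain ⟨a, b, hab, h⟩ := exists_sides hz.1
  rw [h] at hz hw hy
  grind

theorem exists_common_edge {z w : ℤ × ℤ} (h : gridGraph.Adj z w) :
    ∃ e, IsEdgeOf e z ∧ IsEdgeOf e w := by
  obtain ⟨a, b⟩ := z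
  rw [gridGraph_adj_iff] at h
  rcases h with rfl | rfl | rfl | rfl
  · exact ⟨vertEdge (a - 1) b, by simp [isEdgeOf_vertEdge]⟩
  · exact ⟨vertEdge a b, by simp [isEdgeOf_vertEdge]⟩
  · exact ⟨horizEdge a (b - 1), by simp [isEdgeOf_horizEdge]⟩
  · exact ⟨horizEdge a b, by simp [isEdgeOf_horizEdge]⟩

theorem common_edge_unique {e f : Sym2 (ℤ × ℤ)} {z w : ℤ × ℤ} (hne : z ≠ w)
    (hez : IsEdgeOf e z) (hew : IsEdgeOf e w) (hfz : IsEdgeOf f z) (hfw : IsEdgeOf f w) :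
    e = f := by
  rcases eq_vertEdge_or_horizEdge hez.1 with ⟨x, y, rfl⟩ | ⟨x, y, rfl⟩ <;>
  rcases eq_vertEdge_or_horizEdge hfz.1 with ⟨x', y', rfl⟩ | ⟨x', y', rfl⟩ <;>
  simp only [isEdgeOf_vertEdge, isEdgeOf_horizEdge] at hez hew hfz hfw <;>
  rcases hez with rfl | rfl <;> rcases hew with rfl | rfl <;>
  simp_all [Prod.mk.injEq] <;>
  (try congr 1) <;> omega

/-! ### Boundaries of sets of squares, and cycles in leafless graphs -/

/-- The edges separating a square in `S` from a square outside `S`. -/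
def edgeBoundary (S : Set (ℤ × ℤ)) : Set (Sym2 (ℤ × ℤ)) :=
  {e | ∃ z ∈ S, ∃ w ∉ S, IsEdgeOf e z ∧ IsEdgeOf e w}

theorem edgeBoundary_subset (S : Set (ℤ × ℤ)) : edgeBoundary S ⊆ gridGraph.edgeSet := by
  rintro e ⟨z, -, w, -, hz, -⟩
  exact hz.1

theorem mem_edgeBoundary_iff {S : Set (ℤ × ℤ)} {e : Sym2 (ℤ × ℤ)} {z w : ℤ × ℤ}
    (hz : IsEdgeOf e z) (hw : IsEdgeOf e w) (hne : z ≠ w) :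
    e ∈ edgeBoundary S ↔ ¬ (z ∈ S ↔ w ∈ S) := by
  constructor
  · rintro ⟨a, ha, b, hb, hea, heb⟩
    rcases eq_or_eq_of_isEdgeOf hz hw hne hea with rfl | rfl <;>
    rcases eq_or_eq_of_isEdgeOf hz hw hne heb with rfl | rfl <;> tauto
  · intro h
    by_cases hzS : z ∈ S
    · exact ⟨z, hzS, w, by tauto, hz, hw⟩
    · exact ⟨w, by tauto, z, hzS, hw, hz⟩

theorem vertEdge_mem_edgeBoundary (S : Set (ℤ × ℤ)) (x y : ℤ) :
    vertEdge x y ∈ edgeBoundary S ↔ ¬ ((x, y) ∈ S ↔ (x + 1, y) ∈ S) :=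
  mem_edgeBoundary_iff (by simp [isEdgeOf_vertEdge]) (by simp [isEdgeOf_vertEdge]) (by simp)

theorem horizEdge_mem_edgeBoundary (S : Set (ℤ × ℤ)) (x y : ℤ) :
    horizEdge x y ∈ edgeBoundary S ↔ ¬ ((x, y) ∈ S ↔ (x, y + 1) ∈ S) :=
  mem_edgeBoundary_iff (by simp [isEdgeOf_horizEdge]) (by simp [isEdgeOf_horizEdge]) (by simp)

theorem finite_edges_of_square (z : ℤ × ℤ) : {e | IsEdgeOf e z}.Finite := by
  apply Set.Finite.subset (s := {vertEdge z.1 z.2, vertEdge (z.1 - 1) z.2, horizEdge z.1 z.2,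
    horizEdge z.1 (z.2 - 1)}) (by simp)
  intro e he
  obtain ⟨a, b⟩ := z
  rcases eq_vertEdge_or_horizEdge he.1 with ⟨x, y, rfl⟩ | ⟨x, y, rfl⟩
  · rcases (isEdgeOf_vertEdge x y _).1 he with h | h <;> simp only [Prod.mk.injEq] at h <;>
    obtain ⟨rfl, rfl⟩ := h <;> simp
  · rcases (isEdgeOf_horizEdge x y _).1 he with h | h <;> simp only [Prod.mk.injEq] at h <;>
    obtain ⟨rfl, rfl⟩ := h <;> simp

theorem finite_edgeBoundary {S : Set (ℤ × ℤ)} (hS : S.Finite) : (edgeBoundary S).Finite := by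
  apply (hS.biUnion fun z _ => finite_edges_of_square z).subset
  rintro e ⟨z, hz, w, -, hez, -⟩
  exact Set.mem_biUnion hz hez

theorem edgeBoundary_nonempty {S : Set (ℤ × ℤ)} (hS : S.Finite) (hne : S.Nonempty) :
    (edgeBoundary S).Nonempty := by
  -- The right edge of a rightmost square is a boundary edge.
  obtain ⟨⟨x, y⟩, hz, hmax⟩ := Set.exists_max_image S Prod.fst hS hne
  refine ⟨vertEdge x y, (vertEdge_mem_edgeBoundary S x y).2 fun h => ?_⟩
  have := hmax _ (h.1 hz)
  simp at this

/-- The boundary of a set of squares has no vertex of degree one. -/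
theorem exists_other_edge_of_edgeBoundary {S : Set (ℤ × ℤ)} {u v : ℤ × ℤ}
    (h : s(u, v) ∈ edgeBoundary S) : ∃ w, w ≠ u ∧ s(v, w) ∈ edgeBoundary S := by
  obtain ⟨x, y⟩ := v
  have hadj : gridGraph.Adj (x, y) u := (edgeBoundary_subset S h).symm
  have h1 : s((x, y), (x - 1, y)) ∈ edgeBoundary S ↔ _ := horizEdge_mem_edgeBoundary S x y
  have h2 : s((x, y), (x, y - 1)) ∈ edgeBoundary S ↔ _ := vertEdge_mem_edgeBoundary S x y
  have h3 := horizEdge_mem_edgeBoundary S (x + 1) y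
  have h4 := vertEdge_mem_edgeBoundary S x (y + 1)
  rw [horizEdge, add_sub_cancel_right, Sym2.eq_swap] at h3
  rw [vertEdge, add_sub_cancel_right, Sym2.eq_swap] at h4
  rw [Sym2.eq_swap] at h
  -- Going once round the four squares at the corner, membership in `S` changes an even number of
  -- times, so it cannot change exactly once.
  by_contra! hcon
  have c1 := hcon (x - 1, y)
  have c2 := hcon (x, y - 1)
  have c3 := hcon (x + 1, y)
  have c4 := hcon (x, y + 1)
  rw [gridGraph_adj_iff] at hadj
  have hx : x - 1 ≠ x + 1 := by omega
  have hy : y - 1 ≠ y + 1 := by omega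
  rcases hadj with rfl | rfl | rfl | rfl <;>
  simp [hx, hx.symm, hy, hy.symm, h1, h2, h3, h4] at c1 c2 c3 c4 h <;> grind

/-- A finite graph with an edge and no vertex of degree one contains a cycle. -/
theorem exists_isCycle_of_no_leaf {V : Type*} {G : SimpleGraph V} (hfin : G.edgeSet.Finite)
    (hne : G.edgeSet.Nonempty) (h : ∀ u v, G.Adj u v → ∃ w, w ≠ u ∧ G.Adj v w) :
    ∃ (v : V) (c : G.Walk v v), c.IsCycle := by
  classical
  by_contra! hcon
  have hG : G.IsAcyclic := fun v c => hcon v c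
  -- Without cycles, the only neighbour of the end of a path that lies on the path is the
  -- penultimate vertex; a second neighbour therefore extends the path, and paths become longer than
  -- the number of edges.
  have hpath : ∀ n : ℕ, ∃ (u v : V) (p : G.Walk u v), p.IsPath ∧ p.length = n + 1 := by
    intro n
    induction n with
    | zero =>
      obtain ⟨e, he⟩ := hne
      induction e with
      | h u v =>
        exact ⟨u, v, SimpleGraph.Adj.toWalk he, SimpleGraph.Walk.IsPath.of_adj he, rfl⟩
    | succ n ih =>
      obtain ⟨u, v, p, hp, hl⟩ := ih
      have hnil : ¬ p.Nil := by
        rw [← SimpleGraph.Walk.length_eq_zero_iff]; omega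
      obtain ⟨w, hw, hvw⟩ := h _ _ (p.adj_penultimate hnil)
      refine ⟨u, w, p.concat hvw, hp.concat (fun hmem => hw ?_) hvw, by simp [hl]⟩
      exact hG.eq_penultimate_of_adj_end hp hvw hmem
  obtain ⟨u, v, p, hp, hl⟩ := hpath hfin.toFinset.card
  have h1 : p.edges.toFinset.card = p.edges.length :=
    List.toFinset_card_of_nodup hp.isTrail.edges_nodup
  have h2 : p.edges.toFinset ⊆ hfin.toFinset := by
    intro e he
    simpa using p.edges_subset_edgeSet (List.mem_toFinset.1 he)
  have := Finset.card_le_card h2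
  rw [h1, p.length_edges] at this
  omega

/-! ### Closed trails as boundaries modulo 2 -/

section

theorem vertEdge_inj (a b x y : ℤ) : vertEdge a b = vertEdge x y ↔ a = x ∧ b = y := by
  simp only [vertEdge, Sym2.eq_iff, Prod.mk.injEq]; omega

theorem horizEdge_inj (a b x y : ℤ) : horizEdge a b = horizEdge x y ↔ a = x ∧ b = y := by
  simp only [horizEdge, Sym2.eq_iff, Prod.mk.injEq]; omega

theorem vertEdge_ne_horizEdge (a b x y : ℤ) : vertEdge a b ≠ horizEdge x y := by
  simp only [vertEdge, horizEdge, ne_eq, Sym2.eq_iff, Prod.mk.injEq]; omega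

/-- Splits the degree of a vertex into its four incident edges, so that evenness of the degree
becomes the linear relation between `V` and `H` required below. -/
theorem countP_mem_eq (x y : ℤ) (l : List (Sym2 (ℤ × ℤ))) (hl : ∀ e ∈ l, e ∈ gridGraph.edgeSet) :
    l.countP (fun e => (x, y) ∈ e) = l.count (vertEdge x y) + l.count (vertEdge x (y + 1)) +
      l.count (horizEdge x y) + l.count (horizEdge (x + 1) y) := by
  induction l with
  | nil => simp
  | cons e l ih =>
    rw [List.countP_cons, List.count_cons, List.count_cons, List.count_cons, List.count_cons,
      ih fun f hf => hl f (List.mem_cons_of_mem _ hf)]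
    rcases eq_vertEdge_or_horizEdge (hl e List.mem_cons_self) with ⟨a, b, rfl⟩ | ⟨a, b, rfl⟩
    · have h : (x, y) ∈ vertEdge a b ↔ (a = x ∧ b = y) ∨ (a = x ∧ b = y + 1) := by
        simp only [vertEdge, Sym2.mem_iff, Prod.mk.injEq]; omega
      simp only [h, vertEdge_inj, vertEdge_ne_horizEdge, beq_iff_eq, decide_eq_true_eq, if_false]
      split_ifs <;> omega
    · have h : (x, y) ∈ horizEdge a b ↔ (a = x ∧ b = y) ∨ (a = x + 1 ∧ b = y) := by
        simp only [horizEdge, Sym2.mem_iff, Prod.mk.injEq]; omega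
      simp only [h, horizEdge_inj, (vertEdge_ne_horizEdge _ _ _ _).symm, beq_iff_eq,
        decide_eq_true_eq, if_false]
      split_ifs <;> omega

/-- A finite set of grid edges meeting every vertex an even number of times, given by its
characteristic functions `V` and `H` on vertical and horizontal edges, is the boundary of a finite
set of squares. -/
theorem exists_finite_of_even {V H : ℤ → ℤ → ZMod 2} {N : ℤ}
    (hV : ∀ x y, V x y ≠ 0 → |x| ≤ N ∧ |y| ≤ N) (hH : ∀ x y, H x y ≠ 0 → |x| ≤ N ∧ |y| ≤ N)
    (hdeg : ∀ x y, V x y + V x (y + 1) + H x y + H (x + 1) y = 0) :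
    ∃ r : ℤ → ℤ → ZMod 2, {z : ℤ × ℤ | r z.1 z.2 ≠ 0}.Finite ∧
      (∀ x y, V x y = r x y - r (x + 1) y) ∧ ∀ x y, H x y = r x y - r x (y + 1) := by
  have hV0 : ∀ x y, (N < |x| ∨ N < |y|) → V x y = 0 := by
    intro x y h
    by_contra h'
    have := hV x y h'
    omega
  have hH0 : ∀ x y, (N < |x| ∨ N < |y|) → H x y = 0 := by
    intro x y h
    by_contra h'
    have := hH x y h'
    omega
  -- The parity of the crossings of the horizontal ray going right from the centre of the square
  -- `(x, y)`; `N` cuts the ray off beyond the support of `V`.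
  let r : ℤ → ℤ → ZMod 2 := fun x y => ∑ j ∈ Finset.Icc x N, V j y
  have hr0 : ∀ x y, N < x → r x y = 0 := fun x y hx => by
    simp only [r]
    rw [Finset.Icc_eq_empty (by omega), Finset.sum_empty]
  have hr : ∀ x y, r x y = V x y + r (x + 1) y := by
    intro x y
    rcases le_or_gt x N with h | h
    · have : Finset.Icc x N = insert x (Finset.Icc (x + 1) N) := by
        ext j; simp only [Finset.mem_Icc, Finset.mem_insert]; omega
      simp only [r]
      rw [this, Finset.sum_insert (by simp)]
    · rw [hr0 x y h, hr0 (x + 1) y (by omega), hV0 x y (Or.inl (by rw [lt_abs]; omega)), add_zero]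
  have two : ∀ a : ZMod 2, a + a = 0 := CharTwo.add_self_eq_zero
  -- Induction leftwards from the margin `N < x`, where everything vanishes; the degree relation at
  -- `(x, y)` carries the formula from column `x + 1` to column `x`.
  have hrow : ∀ (n : ℕ) x y, N < x + n → H x y = r x y + r x (y + 1) := by
    intro n
    induction n with
    | zero =>
      intro x y hx
      rw [hr0 x y (by simpa using hx), hr0 x _ (by simpa using hx),
        hH0 x y (Or.inl (by rw [lt_abs]; simp at hx; omega)), add_zero]
    | succ n ih =>
      intro x y hx
      have h1 := ih (x + 1) y (by push_cast at hx; omega)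
      have h2 := hdeg x y
      rw [h1] at h2
      rw [hr x y, hr x (y + 1)]
      linear_combination h2 - two (V x y) - two (V x (y + 1)) - two (r (x + 1) y) -
        two (r (x + 1) (y + 1))
  have hrow' : ∀ x y, H x y = r x y + r x (y + 1) := fun x y =>
    hrow (N + 1 - x).toNat x y (by omega)
  have hy0 : ∀ x y, N < |y| → r x y = 0 := fun x y hy =>
    Finset.sum_eq_zero fun j _ => hV0 j y (Or.inr hy)
  -- Left of the box `H` vanishes, so `r` is constant along each column, and it is zero high up.
  -- This makes the support finite on the left too.
  have hx0 : ∀ x, x < -N → ∀ (n : ℕ) y, N < y + n → r x y = 0 := by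
    intro x hx n
    induction n with
    | zero => intro y hy; exact hy0 x y (by rw [lt_abs]; simp at hy; omega)
    | succ n ih =>
      intro y hy
      have h1 := hrow' x y
      rw [ih (y + 1) (by push_cast at hy; omega), hH0 x y (Or.inl (by rw [lt_abs]; omega)),
        add_zero] at h1
      exact h1.symm
  refine ⟨r, ?_, fun x y => ?_, fun x y => ?_⟩
  · apply (Set.finite_Icc (-N, -N) (N, N)).subset
    rintro ⟨x, y⟩ hz
    have h1 : ¬ N < x := fun h => hz (hr0 x y h)
    have h2 : ¬ x < -N := fun h => hz (hx0 x h (N + 1 - y).toNat y (by omega))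
    have h3 : ¬ N < |y| := fun h => hz (hy0 x y h)
    rw [lt_abs] at h3
    simp only [Set.mem_Icc, Prod.mk_le_mk]
    omega
  · rw [hr x y]; ring
  · rw [hrow' x y, CharTwo.sub_eq_add]

variable {G : SimpleGraph (ℤ × ℤ)}

/-- The edges of a closed trail in the grid bound a finite set of squares. -/
theorem exists_edgeBoundary_eq_edges (hG : G ≤ gridGraph) {v : ℤ × ℤ} {w : G.Walk v v}
    (hw : w.IsTrail) : ∃ I : Set (ℤ × ℤ), I.Finite ∧ ∀ e, e ∈ w.edges ↔ e ∈ edgeBoundary I := by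
  have hgrid : ∀ e ∈ w.edges, e ∈ gridGraph.edgeSet := fun e he =>
    SimpleGraph.edgeSet_mono hG (w.edges_subset_edgeSet he)
  let χ : Sym2 (ℤ × ℤ) → ZMod 2 := fun e => (w.edges.count e : ZMod 2)
  have hχ : ∀ e, χ e ≠ 0 ↔ e ∈ w.edges := by
    intro e
    have h1 := List.nodup_iff_count_le_one.1 hw.edges_nodup e
    simp only [χ]
    by_cases he : e ∈ w.edges
    · have h2 := List.count_pos_iff.2 he
      have : w.edges.count e = 1 := by omega
      simp [this, he]
    · simp [List.count_eq_zero.2 he, he]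
  obtain ⟨N, hN⟩ := (w.support.map fun u => max |u.1| |u.2|).toFinset.bddAbove
  have hN' : ∀ e ∈ w.edges, ∀ u ∈ e, |u.1| ≤ N ∧ |u.2| ≤ N := by
    intro e he u hu
    have hs : u ∈ w.support := w.mem_support_of_mem_edges he hu
    exact max_le_iff.1 (hN (by
      rw [Finset.mem_coe, List.mem_toFinset]
      exact List.mem_map_of_mem hs))
  obtain ⟨r, hr, hrV, hrH⟩ := exists_finite_of_even (N := N)
    (V := fun x y => χ (vertEdge x y)) (H := fun x y => χ (horizEdge x y))
    (fun x y h => hN' _ ((hχ _).1 h) (x, y) (Sym2.mem_mk_left _ _))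
    (fun x y h => hN' _ ((hχ _).1 h) (x, y) (Sym2.mem_mk_left _ _))
    (fun x y => by
      have h1 : Even (w.edges.countP fun e => (x, y) ∈ e) :=
        (hw.even_countP_edges_iff (x, y)).2 fun h => absurd rfl h
      rw [countP_mem_eq x y _ hgrid] at h1
      simpa [χ] using (ZMod.natCast_eq_zero_iff_even).2 h1)
  have hmod : ∀ a b : ZMod 2, a - b ≠ 0 ↔ ¬ (a ≠ 0 ↔ b ≠ 0) := by decide
  refine ⟨_, hr, fun e => ?_⟩
  constructor
  · intro he
    rcases eq_vertEdge_or_horizEdge (hgrid e he) with ⟨x, y, rfl⟩ | ⟨x, y, rfl⟩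
    · rw [vertEdge_mem_edgeBoundary]
      exact (hmod _ _).1 (hrV x y ▸ (hχ _).2 he)
    · rw [horizEdge_mem_edgeBoundary]
      exact (hmod _ _).1 (hrH x y ▸ (hχ _).2 he)
  · intro he
    rw [← hχ]
    rcases eq_vertEdge_or_horizEdge (edgeBoundary_subset _ he) with ⟨x, y, rfl⟩ | ⟨x, y, rfl⟩
    · rw [vertEdge_mem_edgeBoundary] at he
      rw [hrV x y]
      exact (hmod _ _).2 he
    · rw [horizEdge_mem_edgeBoundary] at he
      rw [hrH x y]
      exact (hmod _ _).2 he

end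

/-! ### Interior and exterior in the plane, read off from squares -/

section

theorem mem_segment_vertEdge (x y : ℤ) (p : ℝ × ℝ) :
    p ∈ segment ℝ (cornerPoint (x, y)) (cornerPoint (x, y - 1)) ↔
      p.1 = x + 1 / 2 ∧ (y : ℝ) - 1 / 2 ≤ p.2 ∧ p.2 ≤ y + 1 / 2 := by
  obtain ⟨a, b⟩ := p
  rw [segment_symm]
  simp only [cornerPoint]
  rw [← Prod.image_mk_segment_right, segment_eq_Icc (by push_cast; linarith)]
  simp only [Set.mem_image, Set.mem_Icc, Prod.mk.injEq]
  push_cast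
  constructor
  · rintro ⟨⟨h1, h2⟩, rfl, -⟩
    exact ⟨rfl, by linarith, h2⟩
  · rintro ⟨rfl, h1, h2⟩
    exact ⟨⟨by linarith, h2⟩, rfl, rfl⟩

theorem mem_segment_horizEdge (x y : ℤ) (p : ℝ × ℝ) :
    p ∈ segment ℝ (cornerPoint (x, y)) (cornerPoint (x - 1, y)) ↔
      p.2 = y + 1 / 2 ∧ (x : ℝ) - 1 / 2 ≤ p.1 ∧ p.1 ≤ x + 1 / 2 := by
  obtain ⟨a, b⟩ := p
  rw [segment_symm]
  simp only [cornerPoint]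
  rw [← Prod.image_mk_segment_left, segment_eq_Icc (by push_cast; linarith)]
  simp only [Set.mem_image, Set.mem_Icc, Prod.mk.injEq]
  push_cast
  constructor
  · rintro ⟨⟨h1, h2⟩, -, rfl⟩
    exact ⟨rfl, by linarith, h2⟩
  · rintro ⟨rfl, h1, h2⟩
    exact ⟨⟨by linarith, h2⟩, rfl, rfl⟩

variable {G : SimpleGraph (ℤ × ℤ)}

theorem mem_trace_iff (hG : G ≤ gridGraph) (C : G.Subgraph) (p : ℝ × ℝ) : p ∈ trace C ↔
    (∃ x y : ℤ, vertEdge x y ∈ C.edgeSet ∧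
      p.1 = x + 1 / 2 ∧ (y : ℝ) - 1 / 2 ≤ p.2 ∧ p.2 ≤ y + 1 / 2) ∨
    ∃ x y : ℤ, horizEdge x y ∈ C.edgeSet ∧
      p.2 = y + 1 / 2 ∧ (x : ℝ) - 1 / 2 ≤ p.1 ∧ p.1 ≤ x + 1 / 2 := by
  constructor
  · rintro ⟨u, v, huv, hp⟩
    have he : s(u, v) ∈ C.edgeSet := huv
    rcases eq_vertEdge_or_horizEdge (e := s(u, v)) (hG (C.adj_sub huv)) with
      ⟨x, y, h⟩ | ⟨x, y, h⟩
    · refine Or.inl ⟨x, y, h ▸ he, ?_⟩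
      rw [← mem_segment_vertEdge]
      rcases Sym2.eq_iff.1 h with ⟨rfl, rfl⟩ | ⟨rfl, rfl⟩
      · exact hp
      · rwa [segment_symm]
    · refine Or.inr ⟨x, y, h ▸ he, ?_⟩
      rw [← mem_segment_horizEdge]
      rcases Sym2.eq_iff.1 h with ⟨rfl, rfl⟩ | ⟨rfl, rfl⟩
      · exact hp
      · rwa [segment_symm]
  · rintro (⟨x, y, h, hp⟩ | ⟨x, y, h, hp⟩)
    · exact ⟨_, _, h, (mem_segment_vertEdge x y p).2 hp⟩
    · exact ⟨_, _, h, (mem_segment_horizEdge x y p).2 hp⟩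

theorem mem_openSquare (z : ℤ × ℤ) (p : ℝ × ℝ) : p ∈ openSquare z ↔
    ((z.1 : ℝ) - 1 / 2 < p.1 ∧ p.1 < z.1 + 1 / 2) ∧
      (z.2 : ℝ) - 1 / 2 < p.2 ∧ p.2 < z.2 + 1 / 2 := Iff.rfl

/-- If two neighbouring squares are not separated by an edge of `C`, then they can be connected
off `C`. -/
theorem exists_isPreconnected_of_adj (hG : G ≤ gridGraph) (C : G.Subgraph) {z w : ℤ × ℤ}
    (hzw : gridGraph.Adj z w) (hC : ∀ e, IsEdgeOf e z → IsEdgeOf e w → e ∉ C.edgeSet) :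
    ∃ R : Set (ℝ × ℝ), IsPreconnected R ∧ R ⊆ (trace C)ᶜ ∧ openSquare z ⊆ R ∧
      openSquare w ⊆ R := by
  have key1 : ∀ a b : ℤ, vertEdge a b ∉ C.edgeSet → ∃ R : Set (ℝ × ℝ), IsPreconnected R ∧
      R ⊆ (trace C)ᶜ ∧ openSquare (a, b) ⊆ R ∧ openSquare (a + 1, b) ⊆ R := by
    intro a b hab
    -- The open two by one rectangle covering both squares: the only grid edge meeting it is the
    -- shared one, by integrality of the coordinates.
    refine ⟨Set.Ioo ((a : ℝ) - 1 / 2) (a + 3 / 2) ×ˢ Set.Ioo ((b : ℝ) - 1 / 2) (b + 1 / 2),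
      (isPreconnected_Ioo.prod isPreconnected_Ioo), ?_, ?_, ?_⟩
    · rintro p ⟨⟨h1, h2⟩, h3, h4⟩ hp
      rcases (mem_trace_iff hG C p).1 hp with ⟨x, y, he, h5, h6, h7⟩ | ⟨x, y, he, h5, h6, h7⟩
      · have e1 : x < a + 1 := by exact_mod_cast (by linarith : (x : ℝ) < a + 1)
        have e2 : a < x + 1 := by exact_mod_cast (by linarith : (a : ℝ) < x + 1)
        have e3 : y < b + 1 := by exact_mod_cast (by linarith : (y : ℝ) < b + 1)
        have e4 : b < y + 1 := by exact_mod_cast (by linarith : (b : ℝ) < y + 1)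
        obtain rfl : x = a := by omega
        obtain rfl : y = b := by omega
        exact hab he
      · have e3 : y < b := by exact_mod_cast (by linarith : (y : ℝ) < b)
        have e4 : b < y + 1 := by exact_mod_cast (by linarith : (b : ℝ) < y + 1)
        omega
    · rintro p ⟨⟨h1, h2⟩, h3, h4⟩
      exact ⟨⟨h1, by linarith⟩, h3, h4⟩
    · rintro p ⟨⟨h1, h2⟩, h3, h4⟩
      push_cast at h1 h2
      exact ⟨⟨by linarith, by linarith⟩, h3, h4⟩
  have key2 : ∀ a b : ℤ, horizEdge a b ∉ C.edgeSet → ∃ R : Set (ℝ × ℝ), IsPreconnected R ∧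
      R ⊆ (trace C)ᶜ ∧ openSquare (a, b) ⊆ R ∧ openSquare (a, b + 1) ⊆ R := by
    intro a b hab
    refine ⟨Set.Ioo ((a : ℝ) - 1 / 2) (a + 1 / 2) ×ˢ Set.Ioo ((b : ℝ) - 1 / 2) (b + 3 / 2),
      (isPreconnected_Ioo.prod isPreconnected_Ioo), ?_, ?_, ?_⟩
    · rintro p ⟨⟨h1, h2⟩, h3, h4⟩ hp
      rcases (mem_trace_iff hG C p).1 hp with ⟨x, y, he, h5, h6, h7⟩ | ⟨x, y, he, h5, h6, h7⟩
      · have e1 : x < a := by exact_mod_cast (by linarith : (x : ℝ) < a)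
        have e2 : a < x + 1 := by exact_mod_cast (by linarith : (a : ℝ) < x + 1)
        omega
      · have e1 : x < a + 1 := by exact_mod_cast (by linarith : (x : ℝ) < a + 1)
        have e2 : a < x + 1 := by exact_mod_cast (by linarith : (a : ℝ) < x + 1)
        have e3 : y < b + 1 := by exact_mod_cast (by linarith : (y : ℝ) < b + 1)
        have e4 : b < y + 1 := by exact_mod_cast (by linarith : (b : ℝ) < y + 1)
        obtain rfl : x = a := by omega
        obtain rfl : y = b := by omega
        exact hab he
    · rintro p ⟨⟨h1, h2⟩, h3, h4⟩
      exact ⟨⟨h1, h2⟩, h3, by linarith⟩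
    · rintro p ⟨⟨h1, h2⟩, h3, h4⟩
      push_cast at h3 h4
      exact ⟨⟨h1, h2⟩, by linarith, by linarith⟩
  obtain ⟨a, b⟩ := z
  rw [gridGraph_adj_iff] at hzw
  rcases hzw with rfl | rfl | rfl | rfl
  · obtain ⟨R, h1, h2, h3, h4⟩ := key1 (a - 1) b
      (hC _ (by simp [isEdgeOf_vertEdge]) (by simp [isEdgeOf_vertEdge]))
    rw [sub_add_cancel] at h4
    exact ⟨R, h1, h2, h4, h3⟩
  · exact key1 a b (hC _ (by simp [isEdgeOf_vertEdge]) (by simp [isEdgeOf_vertEdge]))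
  · obtain ⟨R, h1, h2, h3, h4⟩ := key2 a (b - 1)
      (hC _ (by simp [isEdgeOf_horizEdge]) (by simp [isEdgeOf_horizEdge]))
    rw [sub_add_cancel] at h4
    exact ⟨R, h1, h2, h4, h3⟩
  · exact key2 a b (hC _ (by simp [isEdgeOf_horizEdge]) (by simp [isEdgeOf_horizEdge]))

theorem openSquare_subset_compl_trace (hG : G ≤ gridGraph) (C : G.Subgraph) (z : ℤ × ℤ) :
    openSquare z ⊆ (trace C)ᶜ := by
  rintro p ⟨⟨h1, h2⟩, h3, h4⟩ hp
  rcases (mem_trace_iff hG C p).1 hp with ⟨x, y, he, h5, h6, h7⟩ | ⟨x, y, he, h5, h6, h7⟩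
  · have e1 : x < z.1 := by exact_mod_cast (by linarith : (x : ℝ) < z.1)
    have e2 : z.1 < x + 1 := by exact_mod_cast (by linarith : (z.1 : ℝ) < x + 1)
    omega
  · have e1 : y < z.2 := by exact_mod_cast (by linarith : (y : ℝ) < z.2)
    have e2 : z.2 < y + 1 := by exact_mod_cast (by linarith : (z.2 : ℝ) < y + 1)
    omega

theorem isPreconnected_openSquare (z : ℤ × ℤ) : IsPreconnected (openSquare z) :=
  isPreconnected_Ioo.prod isPreconnected_Ioo

theorem center_mem_openSquare (z : ℤ × ℤ) : ((z.1 : ℝ), (z.2 : ℝ)) ∈ openSquare z := by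
  rw [mem_openSquare]
  constructor <;> constructor <;> linarith

/-- The dual graph of the tiling, with the adjacencies across the edges in `E` removed. -/
def crossingGraph (E : Set (Sym2 (ℤ × ℤ))) : SimpleGraph (ℤ × ℤ) where
  Adj z w := gridGraph.Adj z w ∧ ∀ e, IsEdgeOf e z → IsEdgeOf e w → e ∉ E
  symm := ⟨fun _ _ h => ⟨h.1.symm, fun e hz hw => h.2 e hw hz⟩⟩
  loopless := ⟨fun _ h => gridGraph.loopless.irrefl _ h.1⟩

theorem openSquare_subset_connectedComponentIn (hG : G ≤ gridGraph) (C : G.Subgraph)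
    {z w : ℤ × ℤ} (h : (crossingGraph C.edgeSet).Reachable z w) {p : ℝ × ℝ}
    (hp : p ∈ openSquare z) : openSquare w ⊆ connectedComponentIn (trace C)ᶜ p := by
  rw [SimpleGraph.reachable_iff_reflTransGen] at h
  induction h with
  | refl =>
    exact (isPreconnected_openSquare z).subset_connectedComponentIn hp
      (openSquare_subset_compl_trace hG C z)
  | @tail b _ _ hadj ih =>
    obtain ⟨R, h1, h2, h3, h4⟩ := exists_isPreconnected_of_adj hG C hadj.1 hadj.2
    have hc := center_mem_openSquare b
    rw [connectedComponentIn_eq (ih hc)]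
    exact h4.trans (h1.subset_connectedComponentIn (h3 hc) h2)

/-- Turns boundedness in the plane into finiteness of sets of squares: the centres lie in a bounded
integer box. -/
theorem finite_of_openSquare_subset {B : Set (ℝ × ℝ)} (hB : Bornology.IsBounded B) :
    {z | openSquare z ⊆ B}.Finite := by
  obtain ⟨R, hR⟩ := hB.subset_closedBall 0
  apply (Set.finite_Icc ((-⌈R⌉, -⌈R⌉) : ℤ × ℤ) (⌈R⌉, ⌈R⌉)).subset
  intro z hz
  have h := hR (hz (center_mem_openSquare z))
  rw [mem_closedBall_zero_iff, Prod.norm_def, max_le_iff, Real.norm_eq_abs, Real.norm_eq_abs,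
    abs_le, abs_le] at h
  have hc := Int.le_ceil R
  obtain ⟨⟨h1, h2⟩, h3, h4⟩ := h
  have a1 : -⌈R⌉ ≤ z.1 := by exact_mod_cast (by push_cast; linarith : ((-⌈R⌉ : ℤ) : ℝ) ≤ z.1)
  have a2 : z.1 ≤ ⌈R⌉ := by exact_mod_cast (by linarith : (z.1 : ℝ) ≤ ⌈R⌉)
  have a3 : -⌈R⌉ ≤ z.2 := by exact_mod_cast (by push_cast; linarith : ((-⌈R⌉ : ℤ) : ℝ) ≤ z.2)
  have a4 : z.2 ≤ ⌈R⌉ := by exact_mod_cast (by linarith : (z.2 : ℝ) ≤ ⌈R⌉)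
  exact ⟨⟨a1, a3⟩, a2, a4⟩

/-- A square from which infinitely many squares can be reached without crossing `C` lies in the
exterior of `C`. -/
theorem squareOutside_of_infinite (hG : G ≤ gridGraph) (C : G.Subgraph) {z : ℤ × ℤ}
    (h : {w | (crossingGraph C.edgeSet).Reachable z w}.Infinite) : SquareOutside z C := by
  intro p hp
  refine ⟨openSquare_subset_compl_trace hG C z hp, fun hb => h ?_⟩
  exact (finite_of_openSquare_subset hb).subset fun w hw =>
    openSquare_subset_connectedComponentIn hG C hw hp

theorem not_squareOutside_of_squareInside {C : G.Subgraph} {z : ℤ × ℤ} (h : SquareInside z C) :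
    ¬ SquareOutside z C := fun h' =>
  (h' (center_mem_openSquare z)).2 (h (center_mem_openSquare z)).2

/-- The closed unit square with centre `z`. -/
def closedSquare (z : ℤ × ℤ) : Set (ℝ × ℝ) :=
  Set.Icc ((z.1 : ℝ) - 1 / 2) ((z.1 : ℝ) + 1 / 2) ×ˢ
    Set.Icc ((z.2 : ℝ) - 1 / 2) ((z.2 : ℝ) + 1 / 2)

theorem mem_closedSquare (z : ℤ × ℤ) (p : ℝ × ℝ) : p ∈ closedSquare z ↔
    ((z.1 : ℝ) - 1 / 2 ≤ p.1 ∧ p.1 ≤ z.1 + 1 / 2) ∧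
      (z.2 : ℝ) - 1 / 2 ≤ p.2 ∧ p.2 ≤ z.2 + 1 / 2 := Iff.rfl

theorem closure_openSquare (z : ℤ × ℤ) : closure (openSquare z) = closedSquare z := by
  rw [openSquare, closure_prod_eq, closure_Ioo (by linarith), closure_Ioo (by linarith),
    closedSquare]

theorem isClosed_closedSquare (z : ℤ × ℤ) : IsClosed (closedSquare z) :=
  isClosed_Icc.prod isClosed_Icc

theorem exists_mem_closedSquare (p : ℝ × ℝ) : ∃ z, p ∈ closedSquare z := by
  have h1 := abs_le.1 (abs_sub_round p.1)
  have h2 := abs_le.1 (abs_sub_round p.2)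
  refine ⟨(round p.1, round p.2), ?_⟩
  rw [mem_closedSquare]
  constructor <;> constructor <;> simp only <;> linarith

theorem locallyFinite_closedSquare : LocallyFinite closedSquare := by
  intro p
  refine ⟨Metric.ball p 1, Metric.ball_mem_nhds p one_pos, ?_⟩
  apply (finite_of_openSquare_subset (Metric.isBounded_ball (x := p) (r := 3))).subset
  rintro z ⟨q, hq, hqp⟩ r hr
  rw [mem_closedSquare] at hq
  rw [mem_openSquare] at hr
  rw [Metric.mem_ball, Prod.dist_eq, max_lt_iff, Real.dist_eq, Real.dist_eq, abs_lt, abs_lt] at *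
  constructor <;> constructor <;> linarith [hqp.1.1, hqp.1.2, hqp.2.1, hqp.2.2]

/-- An open square stays connected when a point of its closure is added, so a point off `C` on the
rim of the square lies in the same component as the square. This handles interior points that are in
no open square. -/
theorem not_squareOutside_of_mem_inside {C : G.Subgraph} (hG : G ≤ gridGraph) {p : ℝ × ℝ}
    {z : ℤ × ℤ} (hp : p ∈ inside C) (hz : p ∈ closedSquare z) : ¬ SquareOutside z C := by
  intro h
  have hconn : IsPreconnected (insert p (openSquare z)) :=
    (isPreconnected_openSquare z).subset_closure (Set.subset_insert _ _)
      (Set.insert_subset (closure_openSquare z ▸ hz) subset_closure)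
  have hsub := hconn.subset_connectedComponentIn (Set.mem_insert _ _)
    (Set.insert_subset hp.1 (openSquare_subset_compl_trace hG C z))
  have hc := center_mem_openSquare z
  apply (h hc).2
  rw [← connectedComponentIn_eq (hsub (Set.mem_insert_of_mem _ hc))]
  exact hp.2

/-- Two squares on different sides of `C` meet only in points of `C`. -/
theorem mem_trace_of_mem_closedSquare (hG : G ≤ gridGraph) {C : G.Subgraph} {I : Set (ℤ × ℤ)}
    (hC : C.edgeSet = edgeBoundary I) {p : ℝ × ℝ} {z w : ℤ × ℤ} (hz : z ∈ I) (hw : w ∉ I)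
    (hpz : p ∈ closedSquare z) (hpw : p ∈ closedSquare w) : p ∈ trace C := by
  have key1 : ∀ a b : ℤ, ¬ ((a, b) ∈ I ↔ (a + 1, b) ∈ I) → p ∈ closedSquare (a, b) →
      p ∈ closedSquare (a + 1, b) → p ∈ trace C := by
    rintro a b h ⟨⟨-, h1⟩, h2, h3⟩ ⟨⟨h4, -⟩, -⟩
    push_cast at h4
    refine (mem_trace_iff hG C p).2 (Or.inl ⟨a, b, ?_, ?_, h2, h3⟩)
    · rwa [hC, vertEdge_mem_edgeBoundary]
    · linarith
  have key2 : ∀ a b : ℤ, ¬ ((a, b) ∈ I ↔ (a, b + 1) ∈ I) → p ∈ closedSquare (a, b) →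
      p ∈ closedSquare (a, b + 1) → p ∈ trace C := by
    rintro a b h ⟨⟨h2, h3⟩, -, h1⟩ ⟨-, h4, -⟩
    push_cast at h4
    refine (mem_trace_iff hG C p).2 (Or.inr ⟨a, b, ?_, ?_, h2, h3⟩)
    · rwa [hC, horizEdge_mem_edgeBoundary]
    · linarith
  have near : ∀ a b : ℤ, ∀ t : ℝ, (a : ℝ) - 1 / 2 ≤ t → t ≤ b + 1 / 2 → a ≤ b + 1 := by
    intro a b t h1 h2
    exact_mod_cast (by linarith : (a : ℝ) ≤ b + 1)
  have row : ∀ a a' b : ℤ, p ∈ closedSquare (a, b) → p ∈ closedSquare (a', b) →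
      ¬ ((a, b) ∈ I ↔ (a', b) ∈ I) → p ∈ trace C := by
    intro a a' b h h' hI
    have h1 := near _ _ _ h.1.1 h'.1.2
    have h2 := near _ _ _ h'.1.1 h.1.2
    simp only at h1 h2
    obtain rfl | rfl | rfl : a' = a ∨ a' = a + 1 ∨ a = a' + 1 := by omega
    · exact absurd Iff.rfl hI
    · exact key1 _ _ hI h h'
    · exact key1 _ _ (fun h => hI h.symm) h' h
  have col : ∀ a b b' : ℤ, p ∈ closedSquare (a, b) → p ∈ closedSquare (a, b') →
      ¬ ((a, b) ∈ I ↔ (a, b') ∈ I) → p ∈ trace C := by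
    intro a b b' h h' hI
    have h1 := near _ _ _ h.2.1 h'.2.2
    have h2 := near _ _ _ h'.2.1 h.2.2
    simp only at h1 h2
    obtain rfl | rfl | rfl : b' = b ∨ b' = b + 1 ∨ b = b' + 1 := by omega
    · exact absurd Iff.rfl hI
    · exact key2 _ _ hI h h'
    · exact key2 _ _ (fun h => hI h.symm) h' h
  -- If the squares meet only diagonally, pass through the square in the column of `w` and the row
  -- of `z`: it also contains `p`, and membership in `I` changes in one of the two straight steps.
  have hpx : p ∈ closedSquare (w.1, z.2) := ⟨hpw.1, hpz.2⟩
  by_cases hx : (w.1, z.2) ∈ I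
  · exact col w.1 z.2 w.2 hpx hpw (fun h => hw (h.1 hx))
  · exact row z.1 w.1 z.2 hpz hpx (fun h => hx (h.1 hz))

/-- A finite set of squares bounded by the edges of `C` lies in the interior of `C`. -/
theorem squareInside_of_edgeSet_eq (hG : G ≤ gridGraph) {C : G.Subgraph} {I : Set (ℤ × ℤ)}
    (hI : I.Finite) (hC : C.edgeSet = edgeBoundary I) {z : ℤ × ℤ} (hz : z ∈ I) :
    SquareInside z C := by
  intro p hp
  have hpC := openSquare_subset_compl_trace hG C z hp
  refine ⟨hpC, ?_⟩
  -- Local finiteness makes the closed squares of `I` and those of its complement two closed sets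
  -- covering the plane. They meet only on the trace, so a connected set off the trace that meets
  -- the first lies in it.
  have hcl : ∀ J : Set (ℤ × ℤ), IsClosed (⋃ w : J, closedSquare w) := fun J =>
    (locallyFinite_closedSquare.comp_injective Subtype.val_injective).isClosed_iUnion
      fun w => isClosed_closedSquare _
  have hsub : connectedComponentIn (trace C)ᶜ p ⊆ ⋃ w : I, closedSquare w := by
    intro q hq
    by_contra hqI
    obtain ⟨x, hx⟩ := exists_mem_closedSquare q
    have hxI : x ∉ I := fun h => hqI (Set.mem_iUnion.2 ⟨⟨x, h⟩, hx⟩)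
    have hcover : connectedComponentIn (trace C)ᶜ p ⊆
        (⋃ w : I, closedSquare w) ∪ ⋃ w : (Iᶜ : Set _), closedSquare w := by
      intro r _
      obtain ⟨y, hy⟩ := exists_mem_closedSquare r
      by_cases hyI : y ∈ I
      · exact Or.inl (Set.mem_iUnion.2 ⟨⟨y, hyI⟩, hy⟩)
      · exact Or.inr (Set.mem_iUnion.2 ⟨⟨y, hyI⟩, hy⟩)
    obtain ⟨r, hr, hr1, hr2⟩ := isPreconnected_closed_iff.1 isPreconnected_connectedComponentIn
      _ _ (hcl I) (hcl Iᶜ) hcover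
      ⟨p, mem_connectedComponentIn hpC,
        Set.mem_iUnion.2 ⟨⟨z, hz⟩, closure_openSquare z ▸ subset_closure hp⟩⟩
      ⟨q, hq, Set.mem_iUnion.2 ⟨⟨x, hxI⟩, hx⟩⟩
    obtain ⟨⟨y1, h1⟩, hy1⟩ := Set.mem_iUnion.1 hr1
    obtain ⟨⟨y2, h2⟩, hy2⟩ := Set.mem_iUnion.1 hr2
    exact connectedComponentIn_subset _ _ hr (mem_trace_of_mem_closedSquare hG hC h1 h2 hy1 hy2)
  refine Bornology.IsBounded.subset ?_ hsub
  have := hI.to_subtype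
  exact Bornology.isBounded_iUnion.2 fun w =>
    (Metric.isBounded_Icc _ _).prod (Metric.isBounded_Icc _ _)

end

/-! ### The filling of a set of squares and its blocks -/

/-- The adjacency of squares by edges, restricted to the squares in `S`. -/
def inducedGrid (S : Set (ℤ × ℤ)) : SimpleGraph (ℤ × ℤ) where
  Adj z w := gridGraph.Adj z w ∧ z ∈ S ∧ w ∈ S
  symm := ⟨fun _ _ h => ⟨h.1.symm, h.2.2, h.2.1⟩⟩
  loopless := ⟨fun _ h => gridGraph.loopless.irrefl _ h.1⟩

/-- The squares outside `A` that are connected to infinity off `A`. -/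
def exteriorSquares (A : Set (ℤ × ℤ)) : Set (ℤ × ℤ) :=
  {z | z ∉ A ∧ {w | (inducedGrid Aᶜ).Reachable z w}.Infinite}

/-- The set `A` with its holes filled. -/
def filling (A : Set (ℤ × ℤ)) : Set (ℤ × ℤ) := (exteriorSquares A)ᶜ

/-- The edge-connected component of `z` in the filling of `A`. -/
def block (A : Set (ℤ × ℤ)) (z : ℤ × ℤ) : Set (ℤ × ℤ) :=
  {w | (inducedGrid (filling A)).Reachable z w}

section Filling

variable {A : Set (ℤ × ℤ)}

theorem subset_filling : A ⊆ filling A := fun _ hz h => h.1 hz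

theorem not_mem_filling {z : ℤ × ℤ} : z ∉ filling A ↔ z ∈ exteriorSquares A := not_not

theorem mem_of_reachable_inducedGrid {S : Set (ℤ × ℤ)} {z w : ℤ × ℤ} (hz : z ∈ S)
    (h : (inducedGrid S).Reachable z w) : w ∈ S := by
  rw [SimpleGraph.reachable_iff_reflTransGen] at h
  induction h with
  | refl => exact hz
  | tail _ hadj _ => exact hadj.2.2

theorem mem_exteriorSquares_of_reachable {z w : ℤ × ℤ} (hz : z ∈ exteriorSquares A)
    (h : (inducedGrid Aᶜ).Reachable z w) : w ∈ exteriorSquares A :=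
  ⟨mem_of_reachable_inducedGrid hz.1 h, hz.2.mono fun _ hx => h.symm.trans hx⟩

theorem mem_exteriorSquares_of_adj {z w : ℤ × ℤ} (hz : z ∈ exteriorSquares A) (hw : w ∉ A)
    (h : gridGraph.Adj z w) : w ∈ exteriorSquares A :=
  mem_exteriorSquares_of_reachable hz (SimpleGraph.Adj.reachable ⟨h, hz.1, hw⟩)

theorem mem_of_adj_exteriorSquares {z w : ℤ × ℤ} (hz : z ∈ exteriorSquares A)
    (hw : w ∈ filling A) (h : gridGraph.Adj z w) : w ∈ A := by
  by_contra hwA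
  exact hw (mem_exteriorSquares_of_adj hz hwA h)

theorem mem_exteriorSquares_of_ray {f : ℕ → ℤ × ℤ} (hinj : Function.Injective f)
    (hadj : ∀ n, gridGraph.Adj (f n) (f (n + 1))) (hA : ∀ n, f n ∉ A) :
    f 0 ∈ exteriorSquares A := by
  refine ⟨hA 0, (Set.infinite_range_of_injective hinj).mono ?_⟩
  rintro _ ⟨n, rfl⟩
  induction n with
  | zero => exact SimpleGraph.Reachable.refl _
  | succ n ih =>
    exact SimpleGraph.Reachable.trans ih (SimpleGraph.Adj.reachable ⟨hadj n, hA n, hA (n + 1)⟩)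

/-- From a square outside a bounding box of `A`, a straight ray escapes without meeting `A`. -/
theorem finite_filling (hA : A.Finite) : (filling A).Finite := by
  obtain ⟨⟨l1, l2⟩, hl⟩ := hA.bddBelow
  obtain ⟨⟨m1, m2⟩, hm⟩ := hA.bddAbove
  have hbox : ∀ x y : ℤ, (x, y) ∈ A → (l1 ≤ x ∧ l2 ≤ y) ∧ x ≤ m1 ∧ y ≤ m2 :=
    fun x y h => ⟨hl h, hm h⟩
  apply (Set.finite_Icc (l1, l2) (m1, m2)).subset
  rintro ⟨x, y⟩ hz
  by_contra hcon
  apply hz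
  have hcases : x < l1 ∨ m1 < x ∨ y < l2 ∨ m2 < y := by
    by_contra! h
    exact hcon ⟨⟨h.1, h.2.2.1⟩, h.2.1, h.2.2.2⟩
  rcases hcases with h | h | h | h
  · simpa using mem_exteriorSquares_of_ray (A := A) (f := fun n : ℕ => (x - n, y))
      (fun a b h => by simpa using h)
      (fun n => (gridGraph_adj_iff _ _).2 (Or.inl (Prod.ext (by push_cast; ring) rfl)))
      (fun n hn => by have := hbox _ _ hn; omega)
  · simpa using mem_exteriorSquares_of_ray (A := A) (f := fun n : ℕ => (x + n, y))
      (fun a b h => by simpa using h)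
      (fun n => (gridGraph_adj_iff _ _).2 (Or.inr (Or.inl (Prod.ext (by push_cast; ring) rfl))))
      (fun n hn => by have := hbox _ _ hn; omega)
  · simpa using mem_exteriorSquares_of_ray (A := A) (f := fun n : ℕ => (x, y - n))
      (fun a b h => by simpa using h)
      (fun n => (gridGraph_adj_iff _ _).2 (Or.inr (Or.inr (Or.inl (Prod.ext rfl (by push_cast; ring))))))
      (fun n hn => by have := hbox _ _ hn; omega)
  · simpa using mem_exteriorSquares_of_ray (A := A) (f := fun n : ℕ => (x, y + n))
      (fun a b h => by simpa using h)
      (fun n => (gridGraph_adj_iff _ _).2 (Or.inr (Or.inr (Or.inr (Prod.ext rfl (by push_cast; ring))))))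
      (fun n hn => by have := hbox _ _ hn; omega)

theorem self_mem_block (z : ℤ × ℤ) : z ∈ block A z := SimpleGraph.Reachable.refl _

theorem block_subset_filling {z : ℤ × ℤ} (hz : z ∈ filling A) : block A z ⊆ filling A :=
  fun _ hw => mem_of_reachable_inducedGrid hz hw

theorem block_eq_of_mem {z w : ℤ × ℤ} (h : w ∈ block A z) : block A w = block A z := by
  ext x
  exact ⟨fun hx => SimpleGraph.Reachable.trans h hx,
    fun hx => (SimpleGraph.Reachable.symm h).trans hx⟩

theorem block_eq_of_adj {z w : ℤ × ℤ} (hz : z ∈ filling A) (hw : w ∈ filling A)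
    (h : gridGraph.Adj z w) : block A w = block A z :=
  block_eq_of_mem (SimpleGraph.Adj.reachable ⟨h, hz, hw⟩)

/-- Every boundary edge of a block separates it from the exterior. -/
theorem exists_sides_of_mem_edgeBoundary_block {z : ℤ × ℤ} (hz : z ∈ filling A)
    {e : Sym2 (ℤ × ℤ)} (he : e ∈ edgeBoundary (block A z)) :
    ∃ a ∈ A, a ∈ block A z ∧ IsEdgeOf e a ∧ ∃ u ∈ exteriorSquares A, IsEdgeOf e u := by
  obtain ⟨a, ha, u, hu, hea, heu⟩ := he
  have hadj := adj_of_isEdgeOf hea heu (by rintro rfl; exact hu ha)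
  have haF := block_subset_filling hz ha
  have huU : u ∈ exteriorSquares A := by
    by_contra h
    exact hu (block_eq_of_mem ha ▸ block_eq_of_adj haF h hadj ▸ self_mem_block u)
  exact ⟨a, mem_of_adj_exteriorSquares huU haF hadj.symm, ha, hea, u, huU, heu⟩

theorem exists_sides_of_mem_edgeBoundary_filling {e : Sym2 (ℤ × ℤ)}
    (he : e ∈ edgeBoundary (filling A)) :
    ∃ a ∈ A, IsEdgeOf e a ∧ ∃ u ∈ exteriorSquares A, IsEdgeOf e u := by
  obtain ⟨a, ha, u, hu, hea, heu⟩ := he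
  rw [not_mem_filling] at hu
  exact ⟨a, mem_of_adj_exteriorSquares hu ha
    (adj_of_isEdgeOf heu hea (by rintro rfl; exact ha hu)), hea, u, hu, heu⟩

theorem edgeBoundary_block_subset {z : ℤ × ℤ} (hz : z ∈ filling A) :
    edgeBoundary (block A z) ⊆ edgeBoundary (filling A) := fun _ he => by
  obtain ⟨a, ha, -, hea, u, hu, heu⟩ := exists_sides_of_mem_edgeBoundary_block hz he
  exact ⟨a, subset_filling ha, u, not_mem_filling.2 hu, hea, heu⟩

/-- The side in the filling of an edge bounding the filling is unique. -/
theorem eq_of_mem_edgeBoundary_filling {e : Sym2 (ℤ × ℤ)} (he : e ∈ edgeBoundary (filling A))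
    {a b : ℤ × ℤ} (ha : a ∈ filling A) (hb : b ∈ filling A) (hea : IsEdgeOf e a)
    (heb : IsEdgeOf e b) : a = b := by
  by_contra hne
  exact (mem_edgeBoundary_iff hea heb hne).1 he (by tauto)

/-- Different blocks have edge-disjoint boundaries, because a boundary edge has only one side in the
filling and that side determines the block. -/
theorem block_eq_of_mem_edgeBoundary {z w : ℤ × ℤ} (hz : z ∈ filling A) (hw : w ∈ filling A)
    {e : Sym2 (ℤ × ℤ)} (hez : e ∈ edgeBoundary (block A z))
    (hew : e ∈ edgeBoundary (block A w)) : block A z = block A w := by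
  obtain ⟨a, ha, haz, hea, -⟩ := exists_sides_of_mem_edgeBoundary_block hz hez
  obtain ⟨b, hb, hbw, heb, -⟩ := exists_sides_of_mem_edgeBoundary_block hw hew
  obtain rfl := eq_of_mem_edgeBoundary_filling (edgeBoundary_block_subset hz hez)
    (subset_filling ha) (subset_filling hb) hea heb
  rw [← block_eq_of_mem haz, block_eq_of_mem hbw]

/-- A finite set of squares all of whose boundary edges are edges of squares in `A` is contained
in the filling of `A`. -/
theorem subset_filling_of_finite {I : Set (ℤ × ℤ)} (hI : I.Finite)
    (h : ∀ e ∈ edgeBoundary I, ∃ a ∈ A, IsEdgeOf e a) : I ⊆ filling A := by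
  intro z hzI hzU
  -- An exterior square in `I` reaches infinitely many squares off `A`, yet such a walk never leaves
  -- the finite set `I`: it would cross an edge with a side in `A`.
  apply hzU.2
  apply hI.subset
  intro w hw
  have hw' : (inducedGrid Aᶜ).Reachable z w := hw
  rw [SimpleGraph.reachable_iff_reflTransGen] at hw'
  induction hw' with
  | refl => exact hzI
  | @tail b c hb hbc ih =>
    have hbI := ih ((SimpleGraph.reachable_iff_reflTransGen _ _).2 hb)
    by_contra hcI
    obtain ⟨e, heb, hec⟩ := exists_common_edge hbc.1
    obtain ⟨a, ha, hea⟩ := h e ⟨b, hbI, c, hcI, heb, hec⟩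
    rcases eq_or_eq_of_isEdgeOf heb hec hbc.1.ne hea with rfl | rfl
    exacts [hbc.2.1 ha, hbc.2.2 ha]

/-- A subset of the filling bounded by edges that bound the filling is a union of blocks. -/
theorem block_subset_of_edgeBoundary_subset {I : Set (ℤ × ℤ)}
    (h : edgeBoundary I ⊆ edgeBoundary (filling A)) {z : ℤ × ℤ} (hz : z ∈ I) :
    block A z ⊆ I := by
  intro w hw
  have hw' : (inducedGrid (filling A)).Reachable z w := hw
  rw [SimpleGraph.reachable_iff_reflTransGen] at hw'
  clear hw
  induction hw' with
  | refl => exact hz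
  | @tail b c hb hbc ih =>
    by_contra hcI
    obtain ⟨e, heb, hec⟩ := exists_common_edge hbc.1
    exact hbc.1.ne (eq_of_mem_edgeBoundary_filling (h ⟨b, ih, c, hcI, heb, hec⟩)
      hbc.2.1 hbc.2.2 heb hec)

theorem edgeBoundary_block_subset_of_subset {I : Set (ℤ × ℤ)} (hI : I ⊆ filling A)
    {z : ℤ × ℤ} (hz : z ∈ filling A) (h : block A z ⊆ I) :
    edgeBoundary (block A z) ⊆ edgeBoundary I := by
  intro e he
  obtain ⟨a, -, ha, hea, u, hu, heu⟩ := exists_sides_of_mem_edgeBoundary_block hz he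
  exact ⟨a, h ha, u, fun huI => hI huI hu, hea, heu⟩

/-- If an edge bounds both `I` and a block, with `I` a union of blocks, then `I` contains the
block. -/
theorem block_subset_of_common_edge {I : Set (ℤ × ℤ)} (hI : I ⊆ filling A)
    (h : edgeBoundary I ⊆ edgeBoundary (filling A)) {z : ℤ × ℤ} (hz : z ∈ filling A)
    {e : Sym2 (ℤ × ℤ)} (he : e ∈ edgeBoundary I) (he' : e ∈ edgeBoundary (block A z)) :
    block A z ⊆ I := by
  obtain ⟨a, -, ha, hea, -⟩ := exists_sides_of_mem_edgeBoundary_block hz he'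
  obtain ⟨b, hb, -, -, heb, -⟩ := id he
  obtain rfl := eq_of_mem_edgeBoundary_filling (h he) (block_subset_filling hz ha) (hI hb) hea heb
  rw [← block_eq_of_mem ha]
  exact block_subset_of_edgeBoundary_subset h hb

end Filling

/-! ### Block cycles and the outermost boundary -/

section Component

variable {occ : Set (ℤ × ℤ)}

theorem componentGraph_le : componentGraph occ ≤ gridGraph := by
  rintro u v ⟨z, -, hz⟩
  exact hz.1

theorem mem_edgeSet_componentGraph {e : Sym2 (ℤ × ℤ)} :
    e ∈ (componentGraph occ).edgeSet ↔ ∃ z ∈ component occ, IsEdgeOf e z := by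
  induction e with
  | h u v => exact Iff.rfl

theorem edgeBoundary_filling_subset :
    edgeBoundary (filling (component occ)) ⊆ (componentGraph occ).edgeSet := fun _ he => by
  obtain ⟨a, ha, hea, -⟩ := exists_sides_of_mem_edgeBoundary_filling he
  exact mem_edgeSet_componentGraph.2 ⟨a, ha, hea⟩

/-- A closed trail in the component graph bounds a finite set of squares in the filling. -/
theorem exists_subset_filling {v : ℤ × ℤ} {w : (componentGraph occ).Walk v v} (hw : w.IsTrail) :
    ∃ I : Set (ℤ × ℤ), I.Finite ∧ I ⊆ filling (component occ) ∧
      ∀ e, e ∈ w.edges ↔ e ∈ edgeBoundary I := by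
  obtain ⟨I, hI, h⟩ := exists_edgeBoundary_eq_edges componentGraph_le hw
  exact ⟨I, hI, subset_filling_of_finite hI fun e he =>
    mem_edgeSet_componentGraph.1 (w.edges_subset_edgeSet ((h e).2 he)), h⟩

/-- The boundary of a block is traversed by a cycle. -/
theorem exists_isCycle_block (hfin : (component occ).Finite) {z : ℤ × ℤ}
    (hz : z ∈ filling (component occ)) :
    ∃ (v : ℤ × ℤ) (c : (componentGraph occ).Walk v v), c.IsCycle ∧
      ∀ e, e ∈ c.edges ↔ e ∈ edgeBoundary (block (component occ) z) := by
  set K := block (component occ) z with hK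
  have hKfin : K.Finite := (finite_filling hfin).subset (block_subset_filling hz)
  have hKsub : edgeBoundary K ⊆ edgeBoundary (filling (component occ)) :=
    edgeBoundary_block_subset hz
  let H := SimpleGraph.fromEdgeSet (edgeBoundary K)
  have hHadj : ∀ u v, H.Adj u v ↔ s(u, v) ∈ edgeBoundary K := fun u v => by
    rw [SimpleGraph.fromEdgeSet_adj]
    exact ⟨fun h => h.1, fun h => ⟨h, gridGraph.ne_of_adj (edgeBoundary_subset K h)⟩⟩
  have hHedge : H.edgeSet = edgeBoundary K := by
    ext e
    induction e with
    | h u v => exact hHadj u v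
  have hHle : H ≤ componentGraph occ := fun u v h =>
    edgeBoundary_filling_subset (hKsub ((hHadj u v).1 h))
  obtain ⟨v, c, hc⟩ := exists_isCycle_of_no_leaf (G := H)
    (hHedge ▸ finite_edgeBoundary hKfin)
    (hHedge ▸ edgeBoundary_nonempty hKfin ⟨z, self_mem_block z⟩)
    (fun u v h => by
      obtain ⟨w, hw, h'⟩ := exists_other_edge_of_edgeBoundary ((hHadj u v).1 h)
      exact ⟨w, hw, (hHadj v w).2 h'⟩)
  have hc' : (c.mapLe hHle).IsCycle := hc.mapLe hHle
  have hedges : ∀ e ∈ (c.mapLe hHle).edges, e ∈ edgeBoundary K := by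
    intro e he
    rw [SimpleGraph.Walk.edges_mapLe_eq_edges] at he
    rw [← hHedge]
    exact c.edges_subset_edgeSet he
  -- The cycle found may a priori use only part of the boundary of `K`. The set `I` it bounds is a
  -- union of blocks sharing an edge with `K`, hence contains `K`, so every boundary edge of `K`
  -- bounds `I` and is on the cycle.
  obtain ⟨I, hIfin, hIF, hI⟩ := exists_subset_filling hc'.isTrail
  have hIK : edgeBoundary I ⊆ edgeBoundary K := fun e he => hedges e ((hI e).2 he)
  refine ⟨v, _, hc', fun e => ⟨hedges e, fun he => (hI e).2 ?_⟩⟩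
  obtain ⟨f, hf⟩ := List.exists_mem_of_ne_nil (c.mapLe hHle).edges fun h => hc'.ne_nil (by
    simpa [SimpleGraph.Walk.eq_nil_iff_nil] using h)
  exact edgeBoundary_block_subset_of_subset hIF hz
    (block_subset_of_common_edge hIF (hIK.trans hKsub) hz ((hI f).1 hf) (hedges f hf)) he

/-- Every edge of `C` has a side in the component, so a step off the component never crosses `C`. -/
theorem inducedGrid_compl_le_crossingGraph (C : (componentGraph occ).Subgraph) :
    inducedGrid (component occ)ᶜ ≤ crossingGraph C.edgeSet := by
  rintro z w ⟨h, hz, hw⟩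
  refine ⟨h, fun e hez hew he => ?_⟩
  obtain ⟨a, ha, hea⟩ := mem_edgeSet_componentGraph.1 (C.edgeSet_subset he)
  rcases eq_or_eq_of_isEdgeOf hez hew h.ne hea with rfl | rfl
  exacts [hz ha, hw ha]

theorem infinite_reachable_of_exterior (C : (componentGraph occ).Subgraph) {z u : ℤ × ℤ}
    (hu : u ∈ exteriorSquares (component occ))
    (h : (crossingGraph C.edgeSet).Reachable z u) :
    {w | (crossingGraph C.edgeSet).Reachable z w}.Infinite :=
  hu.2.mono fun _ hx =>
    h.trans (SimpleGraph.Reachable.mono (inducedGrid_compl_le_crossingGraph C) hx)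

theorem squareOutside_of_exterior (C : (componentGraph occ).Subgraph) {u : ℤ × ℤ}
    (hu : u ∈ exteriorSquares (component occ)) : SquareOutside u C :=
  squareOutside_of_infinite componentGraph_le C
    (infinite_reachable_of_exterior C hu (SimpleGraph.Reachable.refl _))

/-- From a square of another block, walk within that block to one of its boundary edges and cross
into the exterior; that edge is not on `C`, since boundaries of different blocks are disjoint. -/
theorem squareOutside_of_not_mem_block (hfin : (component occ).Finite)
    {C : (componentGraph occ).Subgraph} {z w : ℤ × ℤ} (hz : z ∈ filling (component occ))
    (hC : C.edgeSet = edgeBoundary (block (component occ) z))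
    (hw : w ∉ block (component occ) z) : SquareOutside w C := by
  by_cases hwF : w ∈ filling (component occ)
  · obtain ⟨e, he⟩ := edgeBoundary_nonempty
      ((finite_filling hfin).subset (block_subset_filling hwF)) ⟨w, self_mem_block w⟩
    obtain ⟨a, ha, haw, hea, u, hu, heu⟩ := exists_sides_of_mem_edgeBoundary_block hwF he
    have hau : a ≠ u := by rintro rfl; exact hu.1 ha
    have h1 : inducedGrid (filling (component occ)) ≤ crossingGraph C.edgeSet := by
      rintro x y ⟨h, hx, hy⟩
      refine ⟨h, fun f hfx hfy hf => h.ne ?_⟩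
      rw [hC] at hf
      exact eq_of_mem_edgeBoundary_filling (edgeBoundary_block_subset hz hf) hx hy hfx hfy
    have h2 : (crossingGraph C.edgeSet).Adj a u := by
      refine ⟨adj_of_isEdgeOf hea heu hau, fun f hfa hfu hf => hw ?_⟩
      rw [common_edge_unique hau hfa hfu hea heu, hC] at hf
      rw [block_eq_of_mem_edgeBoundary hz hwF hf he]
      exact self_mem_block w
    exact squareOutside_of_infinite componentGraph_le C
      (infinite_reachable_of_exterior C hu ((SimpleGraph.Reachable.mono h1 haw).trans h2.reachable))
  · exact squareOutside_of_exterior C (not_mem_filling.1 hwF)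

/-- An edge of a component square `a` is not outside the cycle around the block of `a`, so if
outermost it lies on that cycle. Conversely, when an edge bounding the filling is not on `C`,
crossing it leads from its component side to infinity, so both its sides are outside `C`. -/
theorem outermostBoundary_eq (hfin : (component occ).Finite) :
    outermostBoundary occ = edgeBoundary (filling (component occ)) := by
  ext e
  constructor
  · rintro ⟨heG, he⟩
    obtain ⟨a, ha, hea⟩ := mem_edgeSet_componentGraph.1 heG
    have haF := subset_filling ha
    obtain ⟨v, c, hc, hce⟩ := exists_isCycle_block hfin haF
    have hCe : c.toSubgraph.edgeSet = edgeBoundary (block (component occ) a) := by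
      ext f
      rw [SimpleGraph.Walk.mem_edges_toSubgraph, hce]
    rcases he c.toSubgraph ⟨v, c, hc, rfl⟩ with h | h
    · exact edgeBoundary_block_subset haF (hCe ▸ h)
    · exact absurd (h a hea) (not_squareOutside_of_squareInside
        (squareInside_of_edgeSet_eq componentGraph_le
          ((finite_filling hfin).subset (block_subset_filling haF)) hCe (self_mem_block a)))
  · intro he
    refine ⟨edgeBoundary_filling_subset he, fun C _ => or_iff_not_imp_left.2 fun heC y hy => ?_⟩
    obtain ⟨a, ha, hea, u, hu, heu⟩ := exists_sides_of_mem_edgeBoundary_filling he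
    have hau : a ≠ u := by rintro rfl; exact hu.1 ha
    rcases eq_or_eq_of_isEdgeOf hea heu hau hy with rfl | rfl
    · have h : (crossingGraph C.edgeSet).Adj y u := by
        refine ⟨adj_of_isEdgeOf hea heu hau, fun f hfa hfu hf => heC ?_⟩
        rwa [common_edge_unique hau hfa hfu hea heu] at hf
      exact squareOutside_of_infinite componentGraph_le C
        (infinite_reachable_of_exterior C hu h.reachable)
    · exact squareOutside_of_exterior C hu

end Component

/-! ### Minimality of cycles -/

section CycleSubgraph

variable {G : SimpleGraph (ℤ × ℤ)}

theorem IsCycleSubgraph.ncard_neighborSet {C : G.Subgraph} (hC : IsCycleSubgraph C) {v : ℤ × ℤ}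
    (hv : v ∈ C.verts) : (C.neighborSet v).ncard = 2 := by
  obtain ⟨u, w, hw, rfl⟩ := hC
  exact hw.ncard_neighborSet_toSubgraph_eq_two ((w.mem_verts_toSubgraph).1 hv)

theorem IsCycleSubgraph.mem_verts_iff {C : G.Subgraph} (hC : IsCycleSubgraph C) {v : ℤ × ℤ} :
    v ∈ C.verts ↔ ∃ u, C.Adj v u := by
  constructor
  · intro hv
    exact Set.nonempty_of_ncard_ne_zero (s := C.neighborSet v) (by
      rw [hC.ncard_neighborSet hv]; norm_num)
  · rintro ⟨u, hu⟩
    exact C.edge_vert hu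

/-- A cycle contains no other cycle. -/
theorem IsCycleSubgraph.eq_of_edgeSet_subset {C D : G.Subgraph} (hC : IsCycleSubgraph C)
    (hD : IsCycleSubgraph D) (h : C.edgeSet ⊆ D.edgeSet) : C = D := by
  have hadj : ∀ {u v}, C.Adj u v → D.Adj u v := fun {u v} huv =>
    h (show s(u, v) ∈ C.edgeSet from huv)
  -- Both cycles have degree two at `v`, so `D` has no further edge there; walking along `D`, one
  -- can then never leave the vertices of `C`.
  have hnbr : ∀ v ∈ C.verts, C.neighborSet v = D.neighborSet v := by
    intro v hv
    obtain ⟨u, hu⟩ := hC.mem_verts_iff.1 hv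
    have hDv := hD.ncard_neighborSet (D.edge_vert (hadj hu))
    exact Set.eq_of_subset_of_ncard_le (fun x hx => hadj hx)
      (by rw [hC.ncard_neighborSet hv, hDv]) (Set.finite_of_ncard_ne_zero (by rw [hDv]; norm_num))
  have hsub : ∀ y ∈ D.verts, y ∈ C.verts := by
    obtain ⟨x, c, -, hc⟩ := id hC
    have hxC : x ∈ C.verts := by rw [hc]; exact c.start_mem_verts_toSubgraph
    obtain ⟨u, hu⟩ := hC.mem_verts_iff.1 hxC
    have hxD : x ∈ D.verts := D.edge_vert (hadj hu)
    obtain ⟨v, w, hw, rfl⟩ := hD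
    rw [SimpleGraph.Walk.mem_verts_toSubgraph] at hxD
    intro y hy
    rw [← w.toSubgraph_rotate hxD, SimpleGraph.Walk.mem_verts_toSubgraph] at hy
    by_contra hyC
    obtain ⟨d, hd, hd1, hd2⟩ := ((w.rotate x hxD).takeUntil y hy).exists_boundary_dart
      C.verts hxC hyC
    have hde : s(d.fst, d.snd) ∈ (w.rotate x hxD).edges :=
      SimpleGraph.Walk.edges_takeUntil_subset_edges _ hy (List.mem_map_of_mem hd)
    have : d.snd ∈ w.toSubgraph.neighborSet d.fst := by
      rw [← w.toSubgraph_rotate hxD]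
      exact SimpleGraph.Walk.adj_toSubgraph_iff_mem_edges.2 hde
    rw [← hnbr _ hd1] at this
    exact hd2 (C.edge_vert this.symm)
  refine SimpleGraph.Subgraph.ext (Set.Subset.antisymm (fun v hv => ?_) hsub) ?_
  · obtain ⟨u, hu⟩ := hC.mem_verts_iff.1 hv
    exact D.edge_vert (hadj hu)
  · ext u v
    refine ⟨hadj, fun huv => ?_⟩
    have : v ∈ D.neighborSet u := huv
    rwa [← hnbr u (hsub u (D.edge_vert huv))] at this

theorem exists_mem_edges_of_not_nil {V : Type*} {G : SimpleGraph V} {u v : V} {p : G.Walk u v}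
    (h : ¬ p.Nil) : ∃ e, e ∈ p.edges :=
  List.exists_mem_of_ne_nil _ fun h' => h (SimpleGraph.Walk.edges_eq_nil.1 h')

end CycleSubgraph

/-! ### Contacts between block cycles and the circuit -/

section Component

variable {occ : Set (ℤ × ℤ)}

/-- Cycles around different blocks share at most one vertex. -/
theorem eq_of_mem_support_of_mem_support {z w : ℤ × ℤ} (hz : z ∈ filling (component occ))
    (hw : w ∈ filling (component occ)) (hne : block (component occ) z ≠ block (component occ) w)
    {a b : ℤ × ℤ} {c : (componentGraph occ).Walk a a} {d : (componentGraph occ).Walk b b}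
    (hc : c.IsCycle) (hd : d.IsCycle)
    (hce : ∀ e, e ∈ c.edges ↔ e ∈ edgeBoundary (block (component occ) z))
    (hde : ∀ e, e ∈ d.edges ↔ e ∈ edgeBoundary (block (component occ) w))
    {u v : ℤ × ℤ} (huc : u ∈ c.support) (hud : u ∈ d.support) (hvc : v ∈ c.support)
    (hvd : v ∈ d.support) : u = v := by
  by_contra huv
  have hce' : ∀ e, e ∈ (c.rotate u huc).edges ↔ e ∈ edgeBoundary (block (component occ) z) :=
    fun e => by rw [(c.rotate_edges u huc).mem_iff, hce]
  have hde' : ∀ e, e ∈ (d.rotate u hud).edges ↔ e ∈ edgeBoundary (block (component occ) w) :=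
    fun e => by rw [(d.rotate_edges u hud).mem_iff, hde]
  have hc' := hc.isTrail.rotate huc
  have hd' := hd.isTrail.rotate hud
  have hvc' : v ∈ (c.rotate u huc).support := by
    rwa [← SimpleGraph.Walk.mem_verts_toSubgraph, SimpleGraph.Walk.toSubgraph_rotate,
      SimpleGraph.Walk.mem_verts_toSubgraph]
  have hvd' : v ∈ (d.rotate u hud).support := by
    rwa [← SimpleGraph.Walk.mem_verts_toSubgraph, SimpleGraph.Walk.toSubgraph_rotate,
      SimpleGraph.Walk.mem_verts_toSubgraph]
  generalize c.rotate u huc = c' at *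
  generalize d.rotate u hud = d' at *
  have hdisj : ∀ e, e ∈ c'.edges → e ∈ d'.edges → False := fun e h1 h2 =>
    hne (block_eq_of_mem_edgeBoundary hz hw ((hce' e).1 h1) ((hde' e).1 h2))
  have hpsub := c'.edges_takeUntil_subset_edges hvc'
  have hqsub := d'.edges_takeUntil_subset_edges hvd'
  -- An arc of the first cycle from `u` to `v`, closed up by an arc of the second; the cycles have
  -- no common edge.
  have htrail : ((c'.takeUntil v hvc').append (d'.takeUntil v hvd').reverse).IsTrail := by
    rw [SimpleGraph.Walk.isTrail_append]
    refine ⟨hc'.takeUntil hvc', (hd'.takeUntil hvd').reverse, fun e h1 h2 => ?_⟩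
    rw [SimpleGraph.Walk.edges_reverse, List.mem_reverse] at h2
    exact hdisj e (hpsub h1) (hqsub h2)
  obtain ⟨I, hIfin, hIF, hI⟩ := exists_subset_filling htrail
  simp only [SimpleGraph.Walk.edges_append, SimpleGraph.Walk.edges_reverse, List.mem_append,
    List.mem_reverse] at hI
  have hIF' : edgeBoundary I ⊆ edgeBoundary (filling (component occ)) := by
    intro e he
    rcases (hI e).2 he with h | h
    · exact edgeBoundary_block_subset hz ((hce' e).1 (hpsub h))
    · exact edgeBoundary_block_subset hw ((hde' e).1 (hqsub h))
  obtain ⟨e, he⟩ := exists_mem_edges_of_not_nil (p := c'.takeUntil v hvc') fun h => huv h.eq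
  -- The edge `e` puts the block of `z` into `I`, so the trail contains the whole boundary of that
  -- block; but `f`, on the complementary arc of the first cycle, is missing from it.
  obtain ⟨f, hf⟩ := exists_mem_edges_of_not_nil (p := c'.dropUntil v hvc') fun h => huv h.eq.symm
  have hzI := block_subset_of_common_edge hIF hIF' hz ((hI e).1 (Or.inl he))
    ((hce' e).1 (hpsub he))
  have hfc := c'.edges_dropUntil_subset_edges hvc' hf
  rcases (hI f).2 (edgeBoundary_block_subset_of_subset hIF hz hzI ((hce' f).1 hfc)) with h | h
  · exact hc'.disjoint_edges_takeUntil_dropUntil hvc' h hf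
  · exact hdisj f hfc (hqsub h)

/-- The boundaries of the blocks of star adjacent squares touch. -/
theorem exists_common_corner {A : Set (ℤ × ℤ)} {z w : ℤ × ℤ} (hz : z ∈ filling A)
    (hw : w ∈ filling A) (hzw : starGraph.Adj z w) (hne : block A w ≠ block A z) :
    ∃ v, (∃ e ∈ edgeBoundary (block A z), v ∈ e) ∧ ∃ e ∈ edgeBoundary (block A w), v ∈ e := by
  obtain ⟨a, b⟩ := z
  obtain ⟨c, d⟩ := w
  obtain ⟨-, ⟨x, y⟩, ⟨h1, h2⟩, h3, h4⟩ := hzw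
  simp only at h1 h2 h3 h4
  have hac : a ≠ c := by
    rintro rfl
    rcases eq_or_ne b d with rfl | hbd
    · exact hne rfl
    · exact hne (block_eq_of_adj hz hw (by
        rw [gridGraph_adj_iff]; simp only [Prod.mk.injEq, true_and]; omega))
  have hbd : b ≠ d := by
    rintro rfl
    exact hne (block_eq_of_adj hz hw (by
      rw [gridGraph_adj_iff]; simp only [Prod.mk.injEq, and_true]; omega))
  have hza : gridGraph.Adj (a, b) (a, d) := by
    rw [gridGraph_adj_iff]; simp only [Prod.mk.injEq, true_and]; omega
  have hwa : gridGraph.Adj (c, d) (a, d) := by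
    rw [gridGraph_adj_iff]; simp only [Prod.mk.injEq, and_true]; omega
  -- The squares are diagonal neighbours, and `(a, d)` shares an edge with each; in the filling it
  -- would merge the two blocks. Its edges towards them therefore bound the blocks, and both end at
  -- the common corner.
  have hx : (a, d) ∉ filling A := fun h =>
    hne ((block_eq_of_adj hw h hwa).symm.trans (block_eq_of_adj hz h hza))
  refine ⟨(x, y), ⟨horizEdge a y, ⟨(a, b), self_mem_block _, (a, d),
    fun h => hx (block_subset_filling hz h), ?_, ?_⟩, ?_⟩, ⟨vertEdge x d, ⟨(c, d),
    self_mem_block _, (a, d), fun h => hx (block_subset_filling hw h), ?_, ?_⟩, ?_⟩⟩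
  · simp only [isEdgeOf_horizEdge, Prod.mk.injEq, true_and]; omega
  · simp only [isEdgeOf_horizEdge, Prod.mk.injEq, true_and]; omega
  · simp only [horizEdge, Sym2.mem_iff, Prod.mk.injEq, and_true]; omega
  · simp only [isEdgeOf_vertEdge, Prod.mk.injEq, and_true]; omega
  · simp only [isEdgeOf_vertEdge, Prod.mk.injEq, and_true]; omega
  · simp only [vertEdge, Sym2.mem_iff, Prod.mk.injEq, true_and]; omega

theorem zero_mem_component (h0 : (0 : ℤ × ℤ) ∈ occ) : (0 : ℤ × ℤ) ∈ component occ :=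
  ⟨SimpleGraph.Walk.nil, SimpleGraph.Walk.IsPath.nil, by simpa using h0⟩

theorem mem_component_of_adj {z w : ℤ × ℤ} (hz : z ∈ component occ) (hw : w ∈ occ)
    (h : starGraph.Adj w z) : w ∈ component occ := by
  obtain ⟨p, -, hp⟩ := hz
  refine ⟨(SimpleGraph.Walk.cons h p).bypass, SimpleGraph.Walk.bypass_isPath _, fun y hy => ?_⟩
  have := SimpleGraph.Walk.support_bypass_subset_support _ hy
  rw [SimpleGraph.Walk.support_cons, List.mem_cons] at this
  rcases this with rfl | h
  exacts [hw, hp y h]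

theorem starGraph_adj_of_gridGraph_adj {z w : ℤ × ℤ} (h : gridGraph.Adj z w) :
    starGraph.Adj z w := by
  obtain ⟨e, hz, hw⟩ := exists_common_edge h
  refine ⟨h.ne, ?_⟩
  induction e with
  | h u v => exact ⟨u, hz.2 u (Sym2.mem_mk_left _ _), hw.2 u (Sym2.mem_mk_left _ _)⟩

/-- A proper part of the component containing the origin is star adjacent to the rest. -/
theorem exists_star_adj {T : Set (ℤ × ℤ)} (h0 : (0 : ℤ × ℤ) ∈ T) {x : ℤ × ℤ}
    (hx : x ∈ component occ) (hxT : x ∉ T) :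
    ∃ y ∈ component occ, y ∉ T ∧ ∃ y' ∈ T, starGraph.Adj y' y := by
  obtain ⟨p, hp, hpocc⟩ := hx
  obtain ⟨d, hd, hd1, hd2⟩ := p.exists_boundary_dart Tᶜ hxT (fun h => h h0)
  have hdp : d.fst ∈ p.support := p.dart_fst_mem_support_of_mem_darts hd
  exact ⟨d.fst, ⟨p.dropUntil d.fst hdp, hp.dropUntil hdp, fun y hy =>
    hpocc y (p.support_dropUntil_subset_support hdp hy)⟩, hd1, d.snd, not_not.1 hd2, d.adj.symm⟩

/-- The edges bounding the filling are traversed by a circuit. -/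
theorem exists_isCircuit (h0 : (0 : ℤ × ℤ) ∈ occ) (hfin : (component occ).Finite) :
    ∃ (v : ℤ × ℤ) (w : (componentGraph occ).Walk v v), w.IsCircuit ∧
      ∀ e, e ∈ w.edges ↔ e ∈ edgeBoundary (filling (component occ)) := by
  set A := component occ with hA
  -- The parts of the component whose block boundaries together are traversed by one circuit. A
  -- maximal part is everything: otherwise a star adjacent square adds no new block, or its cycle
  -- can be spliced in at a common corner.
  let S : Set (Set (ℤ × ℤ)) := {T | T ⊆ A ∧ 0 ∈ T ∧
    ∃ (v : ℤ × ℤ) (w : (componentGraph occ).Walk v v), w.IsCircuit ∧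
      ∀ e, e ∈ w.edges ↔ ∃ z ∈ T, e ∈ edgeBoundary (block A z)}
  have hSfin : S.Finite := hfin.finite_subsets.subset fun T hT => hT.1
  have hSne : S.Nonempty := by
    have h0A := zero_mem_component h0
    obtain ⟨v, c, hc, hce⟩ := exists_isCycle_block hfin (subset_filling h0A)
    exact ⟨{0}, by simpa using h0A, rfl, v, c, hc.isCircuit, by simpa using hce⟩
  obtain ⟨T, ⟨hTA, h0T, v, w, hw, hwe⟩, hmax⟩ := hSfin.exists_maximal hSne
  have hTA' : ∀ x ∈ A, x ∈ T := by
    by_contra! hcon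
    obtain ⟨x, hxA, hxT⟩ := hcon
    obtain ⟨y, hyA, hyT, t, htT, hty⟩ := exists_star_adj h0T hxA hxT
    suffices h : insert y T ∈ S from
      hyT (hmax h (Set.subset_insert _ _) (Set.mem_insert _ _))
    refine ⟨Set.insert_subset hyA hTA, Set.mem_insert_of_mem _ h0T, ?_⟩
    by_cases hblock : ∃ s ∈ T, block A s = block A y
    · obtain ⟨s, hsT, hs⟩ := hblock
      refine ⟨v, w, hw, fun e => ?_⟩
      rw [hwe, Set.exists_mem_insert, ← hs]
      exact ⟨Or.inr, fun h => h.elim (fun h => ⟨s, hsT, h⟩) id⟩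
    · push Not at hblock
      obtain ⟨u, ⟨e, he, hue⟩, f, hf, huf⟩ := exists_common_corner
        (subset_filling (hTA htT)) (subset_filling hyA) hty (hblock t htT).symm
      obtain ⟨v', c, hc, hce⟩ := exists_isCycle_block hfin (subset_filling hyA)
      have huw : u ∈ w.support := w.mem_support_of_mem_edges ((hwe e).2 ⟨t, htT, he⟩) hue
      have huc : u ∈ c.support := c.mem_support_of_mem_edges ((hce f).2 hf) huf
      refine ⟨u, (w.rotate u huw).append (c.rotate u huc), ⟨?_, ?_⟩, fun g => ?_⟩
      · rw [SimpleGraph.Walk.isTrail_append]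
        refine ⟨hw.isTrail.rotate huw, hc.isTrail.rotate huc, fun g h1 h2 => ?_⟩
        rw [(w.rotate_edges u huw).mem_iff, hwe] at h1
        rw [(c.rotate_edges u huc).mem_iff, hce] at h2
        obtain ⟨s, hsT, hs⟩ := h1
        exact hblock s hsT (block_eq_of_mem_edgeBoundary (subset_filling (hTA hsT))
          (subset_filling hyA) hs h2)
      · intro h
        have h1 : e ∈ (w.rotate u huw).edges := by
          rw [(w.rotate_edges u huw).mem_iff, hwe]
          exact ⟨t, htT, he⟩
        have h2 := congrArg SimpleGraph.Walk.edges h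
        rw [SimpleGraph.Walk.edges_append, SimpleGraph.Walk.edges_nil,
          List.append_eq_nil_iff] at h2
        rw [h2.1] at h1
        exact List.not_mem_nil h1
      · rw [SimpleGraph.Walk.edges_append, List.mem_append, (w.rotate_edges u huw).mem_iff, hwe,
          (c.rotate_edges u huc).mem_iff, hce, Set.exists_mem_insert, or_comm]
  refine ⟨v, w, hw, fun e => ?_⟩
  rw [hwe]
  constructor
  · rintro ⟨z, hz, he⟩
    exact edgeBoundary_block_subset (subset_filling (hTA hz)) he
  · intro he
    obtain ⟨a, ha, hea, u, hu, heu⟩ := exists_sides_of_mem_edgeBoundary_filling he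
    exact ⟨a, hTA' a ha, a, self_mem_block a, u,
      fun h => block_subset_filling (subset_filling ha) h hu, hea, heu⟩

/-! ### The family of block cycles -/

/-- The cycles around the blocks of the filled component. -/
def blockCycles (occ : Set (ℤ × ℤ)) : Set (componentGraph occ).Subgraph :=
  {C | IsCycleSubgraph C ∧ ∃ z ∈ filling (component occ),
    C.edgeSet = edgeBoundary (block (component occ) z)}

theorem exists_mem_blockCycles (hfin : (component occ).Finite) {z : ℤ × ℤ}
    (hz : z ∈ filling (component occ)) :
    ∃ C ∈ blockCycles occ, C.edgeSet = edgeBoundary (block (component occ) z) := by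
  obtain ⟨v, c, hc, hce⟩ := exists_isCycle_block hfin hz
  have h : c.toSubgraph.edgeSet = edgeBoundary (block (component occ) z) := by
    ext e
    rw [SimpleGraph.Walk.mem_edges_toSubgraph, hce]
  exact ⟨c.toSubgraph, ⟨⟨v, c, hc, rfl⟩, z, hz, h⟩, h⟩

theorem finite_blockCycles (hfin : (component occ).Finite) : (blockCycles occ).Finite := by
  have h : ∀ z ∈ filling (component occ), {C : (componentGraph occ).Subgraph |
      IsCycleSubgraph C ∧ C.edgeSet = edgeBoundary (block (component occ) z)}.Finite :=
    fun z _ => Set.Subsingleton.finite fun C hC D hD =>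
      hC.1.eq_of_edgeSet_subset hD.1 (hC.2.trans hD.2.symm).subset
  apply ((finite_filling hfin).biUnion h).subset
  rintro C ⟨hC, z, hz, hCz⟩
  exact Set.mem_biUnion hz ⟨hC, hCz⟩

theorem edgeBoundary_filling_eq_iUnion (hfin : (component occ).Finite) :
    edgeBoundary (filling (component occ)) = ⋃ C ∈ blockCycles occ, C.edgeSet := by
  ext e
  simp only [Set.mem_iUnion, exists_prop]
  constructor
  · rintro ⟨a, ha, u, hu, hea, heu⟩
    obtain ⟨C, hC, hCa⟩ := exists_mem_blockCycles hfin ha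
    exact ⟨C, hC, hCa ▸ ⟨a, self_mem_block a, u, fun h => hu (block_subset_filling ha h),
      hea, heu⟩⟩
  · rintro ⟨C, ⟨-, z, hz, hC⟩, he⟩
    exact edgeBoundary_block_subset hz (hC ▸ he)

/-- The union of the cycles is the subgraph traced by the circuit, hence connected. Equality of
vertex sets holds because neither side has an isolated vertex. -/
theorem connected_sSup_blockCycles (h0 : (0 : ℤ × ℤ) ∈ occ) (hfin : (component occ).Finite) :
    (sSup (blockCycles occ)).Connected := by
  obtain ⟨v, w, hw, hwe⟩ := exists_isCircuit h0 hfin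
  have hedge : (sSup (blockCycles occ)).edgeSet = w.toSubgraph.edgeSet := by
    ext e
    rw [SimpleGraph.Subgraph.edgeSet_sSup, ← edgeBoundary_filling_eq_iUnion hfin, ← hwe,
      SimpleGraph.Walk.mem_edges_toSubgraph]
  have hadj : ∀ x y, (sSup (blockCycles occ)).Adj x y ↔ w.toSubgraph.Adj x y := fun x y => by
    rw [← SimpleGraph.Subgraph.mem_edgeSet, hedge, SimpleGraph.Subgraph.mem_edgeSet]
  have heq : sSup (blockCycles occ) = w.toSubgraph := by
    refine SimpleGraph.Subgraph.ext (Set.ext fun x => ?_) ?_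
    · constructor
      · intro hx
        rw [SimpleGraph.Subgraph.verts_sSup] at hx
        simp only [Set.mem_iUnion, exists_prop] at hx
        obtain ⟨C, hC, hx⟩ := hx
        obtain ⟨y, hy⟩ := hC.1.mem_verts_iff.1 hx
        exact w.toSubgraph.edge_vert
          ((hadj x y).1 (SimpleGraph.Subgraph.sSup_adj.2 ⟨C, hC, hy⟩))
      · intro hx
        rw [SimpleGraph.Walk.mem_verts_toSubgraph,
          SimpleGraph.Walk.mem_support_iff_exists_mem_edges_of_not_nil
            (fun h => hw.ne_nil (SimpleGraph.Walk.eq_nil_iff_nil.2 h))] at hx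
        obtain ⟨e, he, hxe⟩ := hx
        rw [← SimpleGraph.Walk.mem_edges_toSubgraph, ← hedge] at he
        exact SimpleGraph.Subgraph.mem_verts_of_mem_edge he hxe
    · ext x y
      exact hadj x y
  rw [heq]
  exact w.toSubgraph_connected

theorem disjoint_inside_of_mem_blockCycles (hfin : (component occ).Finite)
    {C D : (componentGraph occ).Subgraph} {z w : ℤ × ℤ} (hz : z ∈ filling (component occ))
    (hw : w ∈ filling (component occ))
    (hC : C.edgeSet = edgeBoundary (block (component occ) z))
    (hD : D.edgeSet = edgeBoundary (block (component occ) w))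
    (hne : block (component occ) z ≠ block (component occ) w) :
    Disjoint (inside C) (inside D) := by
  rw [Set.disjoint_left]
  intro p hpC hpD
  obtain ⟨x, hx⟩ := exists_mem_closedSquare p
  have h1 : x ∈ block (component occ) z := by
    by_contra h
    exact not_squareOutside_of_mem_inside componentGraph_le hpC hx
      (squareOutside_of_not_mem_block hfin hz hC h)
  have h2 : x ∈ block (component occ) w := by
    by_contra h
    exact not_squareOutside_of_mem_inside componentGraph_le hpD hx
      (squareOutside_of_not_mem_block hfin hw hD h)
  exact hne ((block_eq_of_mem h1).symm.trans (block_eq_of_mem h2))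

/-- Every cycle consisting of edges that bound the filling is a cycle around a block. -/
theorem mem_blockCycles_of_edgeSet_subset (hfin : (component occ).Finite)
    {C : (componentGraph occ).Subgraph} (hC : IsCycleSubgraph C)
    (h : C.edgeSet ⊆ edgeBoundary (filling (component occ))) : C ∈ blockCycles occ := by
  obtain ⟨v, w, hw, hCw⟩ := id hC
  obtain ⟨I, -, hIF, hI⟩ := exists_subset_filling hw.isTrail
  have hCI : C.edgeSet = edgeBoundary I := by
    ext e
    rw [hCw, SimpleGraph.Walk.mem_edges_toSubgraph, hI]
  rw [hCI] at h
  obtain ⟨e, he⟩ := exists_mem_edges_of_not_nil (p := w) fun h =>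
    hw.ne_nil (SimpleGraph.Walk.eq_nil_iff_nil.2 h)
  obtain ⟨z, hz, -⟩ := (hI e).1 he
  obtain ⟨D, hD, hDz⟩ := exists_mem_blockCycles hfin (hIF hz)
  have hsub : D.edgeSet ⊆ C.edgeSet := by
    rw [hDz, hCI]
    exact edgeBoundary_block_subset_of_subset hIF (hIF hz)
      (block_subset_of_edgeBoundary_subset h hz)
  rwa [← hD.1.eq_of_edgeSet_subset hC hsub]

end Component

end StarPercolation

/-! ### Assembly of the theorem -/

open StarPercolation in
theorem theorem1 (occ : Set (ℤ × ℤ)) (h0 : (0 : ℤ × ℤ) ∈ occ)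
    (hfin : (StarPercolation.component occ).Finite) :
    (∃! 𝒞 : Set (StarPercolation.componentGraph occ).Subgraph,
      𝒞.Finite ∧
      (∀ C ∈ 𝒞, StarPercolation.IsCycleSubgraph C) ∧
      StarPercolation.outermostBoundary occ = (⋃ C ∈ 𝒞, C.edgeSet) ∧
      -- (i)
      (∀ C ∈ 𝒞, ∀ e ∈ C.edgeSet, e ∈ StarPercolation.outermostBoundary occ) ∧
      -- (ii)
      (sSup 𝒞).Connected ∧
      -- (iii)
      (∀ C ∈ 𝒞, ∀ D ∈ 𝒞, C ≠ D →
        Disjoint (StarPercolation.inside C) (StarPercolation.inside D) ∧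
        (C.verts ∩ D.verts).Subsingleton) ∧
      -- (iv)
      (∀ z ∈ StarPercolation.component occ, ∃ C ∈ 𝒞, StarPercolation.SquareInside z C) ∧
      -- (v)
      (∀ C ∈ 𝒞, ∀ e ∈ C.edgeSet,
        StarPercolation.IsBoundaryEdge occ e ∧
        (∃ z ∈ StarPercolation.component occ,
          StarPercolation.IsEdgeOf e z ∧ StarPercolation.SquareInside z C) ∧
        (∃ z, z ∉ occ ∧ StarPercolation.IsEdgeOf e z ∧
          ∀ D ∈ 𝒞, StarPercolation.SquareOutside z D))) ∧
    -- the circuit traversing exactly the edges of the outermost boundary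
    (∃ (v : ℤ × ℤ) (w : (StarPercolation.componentGraph occ).Walk v v), w.IsCircuit ∧
      ∀ e, e ∈ w.edges ↔ e ∈ StarPercolation.outermostBoundary occ) := by
  have hF := outermostBoundary_eq hfin
  have hU := edgeBoundary_filling_eq_iUnion hfin
  have hKfin : ∀ z ∈ filling (component occ), (block (component occ) z).Finite := fun z hz =>
    (finite_filling hfin).subset (block_subset_filling hz)
  rw [hF]
  refine ⟨⟨blockCycles occ, ⟨finite_blockCycles hfin, fun C hC => hC.1, hU, ?_,
    connected_sSup_blockCycles h0 hfin, ?_, ?_, ?_⟩, ?_⟩, exists_isCircuit h0 hfin⟩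
  · rintro C ⟨-, z, hz, hC⟩ e he
    exact edgeBoundary_block_subset hz (hC ▸ he)
  · rintro C ⟨hCc, z, hz, hC⟩ D ⟨hDc, w, hw, hD⟩ hCD
    have hne : block (component occ) z ≠ block (component occ) w := fun h =>
      hCD (hCc.eq_of_edgeSet_subset hDc (by rw [hC, hD, h]))
    refine ⟨disjoint_inside_of_mem_blockCycles hfin hz hw hC hD hne, ?_⟩
    rintro u ⟨huC, huD⟩ v ⟨hvC, hvD⟩
    obtain ⟨a, c, hc, rfl⟩ := hCc
    obtain ⟨b, d, hd, rfl⟩ := hDc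
    rw [SimpleGraph.Walk.mem_verts_toSubgraph] at huC huD hvC hvD
    exact eq_of_mem_support_of_mem_support hz hw hne hc hd
      (fun e => by rw [← hC, SimpleGraph.Walk.mem_edges_toSubgraph])
      (fun e => by rw [← hD, SimpleGraph.Walk.mem_edges_toSubgraph]) huC huD hvC hvD
  · intro z hz
    obtain ⟨C, hC, hCz⟩ := exists_mem_blockCycles hfin (subset_filling hz)
    exact ⟨C, hC, squareInside_of_edgeSet_eq componentGraph_le (hKfin z (subset_filling hz)) hCz
      (self_mem_block z)⟩
  · rintro C ⟨-, z, hz, hC⟩ e he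
    obtain ⟨a, ha, haz, hea, u, hu, heu⟩ := exists_sides_of_mem_edgeBoundary_block hz (hC ▸ he)
    -- An occupied neighbour of a component square would belong to the component, whereas `u` is
    -- exterior.
    have huocc : u ∉ occ := fun h => hu.1 (mem_component_of_adj ha h
      (starGraph_adj_of_gridGraph_adj
        (adj_of_isEdgeOf heu hea (by rintro rfl; exact hu.1 ha))))
    exact ⟨⟨⟨u, huocc, heu⟩, a, ha, hea⟩,
      ⟨a, ha, hea, squareInside_of_edgeSet_eq componentGraph_le (hKfin z hz) hC haz⟩,
      u, huocc, heu, fun D _ => squareOutside_of_exterior D hu⟩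
  · rintro 𝒟 ⟨-, hcyc, -, hsub, -, -, hin, -⟩
    have hmem : ∀ C ∈ 𝒟, C ∈ blockCycles occ := fun C hC =>
      mem_blockCycles_of_edgeSet_subset hfin (hcyc C hC) (hsub C hC)
    refine Set.Subset.antisymm hmem ?_
    rintro C ⟨hCc, z, hz, hC⟩
    -- The block contains a component square `a`, found beside a boundary edge. By (iv) some cycle
    -- of `𝒟` has `a` inside; being a block cycle, it must go around the block of `a`.
    obtain ⟨e, he⟩ := edgeBoundary_nonempty (hKfin z hz) ⟨z, self_mem_block z⟩
    obtain ⟨a, ha, haz, -⟩ := exists_sides_of_mem_edgeBoundary_block hz he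
    obtain ⟨D, hD, haD⟩ := hin a ha
    obtain ⟨hDc, w, hw, hDw⟩ := hmem D hD
    have haw : a ∈ block (component occ) w := by
      by_contra h
      exact not_squareOutside_of_squareInside haD (squareOutside_of_not_mem_block hfin hw hDw h)
    rwa [hCc.eq_of_edgeSet_subset hDc
      (by rw [hC, hDw, ← block_eq_of_mem haz, block_eq_of_mem haw])]
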